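/- Let $N\ge 2$, $1<p<\infty$, $0<s<1$, $\varepsilon\in(0,1]$, let $\Omega\subset\mathbb{R}^N$ be an open set (for example a bounded $C^1$ domain), and let $g\in L^\infty(\Omega)$. Let $H:\mathbb{R}^N\to[0,\infty)$ be a Finsler–Minkowski norm: $H\in C^1(\mathbb{R}^N\setminus\{0\})$, $H(x)=0$ iff $x=0$, $H(tx)=|t|H(x)$ for $t\in\mathbb{R}$, $C_1|x|\le H(x)\le C_2|x|$ with constants $C_1,C_2>0$, and $H$ is strictly convex as a norm, that is, $H(ax+by)<aH(x)+bH(y)$ whenever $a,b>0$, $a+b=1$ and $x,y$ do not lie on a common ray from the origin. Let $u\in W^{1,p}_{\mathrm{loc}}(\Omega)\cap L^{ps}_{p-1}(\mathbb{R}^N)$, where $L^{ps}_{p-1}(\mathbb{R}^N)$ consists of all $u\in L^{p-1}_{\mathrm{loc}}(\mathbb{R}^N)$ with $\int_{\mathbb{R}^N}|u(y)|^{p-1}(1+|y|)^{-N-ps}\,dy<\infty$. Suppose that $u$ is a weak supersolution in $\Omega$ of $$-\operatorname{div}\big(H(\nabla u)^{p-1}\nabla H(\nabla u)\big)+\varepsilon(-\Delta_p)^s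 u=g(x)|u|^{p-2}u ,$$ that is, for every open $\Omega'\Subset\Omega$ and every $\phi\in W^{1,p}(\mathbb{R}^N)$ with $\phi\ge 0$ a.e. and $\phi=0$ a.e. in $\mathbb{R}^N\setminus\Omega'$, $$\int_{\Omega'}H(\nabla u)^{p-1}\nabla H(\nabla u)\cdot\nabla\phi\,dx+\varepsilon\iint_{\mathbb{R}^{2N}}\frac{|u(x)-u(y)|^{p-2}(u(x)-u(y))(\phi(x)-\phi(y))}{|x-y|^{N+ps}}\,dx\,dy-\int_{\Omega'}g|u|^{p-2}u\,\phi\,dx\ \ge\ 0 .$$ Suppose also that $u$ is essentially bounded below in $\mathbb{R}^N$. Fix a real-valued representative of $u$ and define $$u_*(x)=\lim_{r\to0^+}\operatorname*{ess\,inf}_{B_r(x)}u\in[-\infty,+\infty],\qquad \mathcal{E}=\Big\{x\in\Omega:\ \lim_{r\to 0^+}\frac{1}{|B_r(x)|}\int_{B_r(x)}|u(x)-u(y)|\,dy=0\Big\}.$$ **(1) Lower semicontinuity.** $u(x)=u_*(x)$ for every $x\in\mathcal{E}$. In particular $u_*$ is a lower semicontinuous representative of $u$ in $\Omega$: $u_*$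 is lower semicontinuous in $\Omega$ and $u_*=u$ a.e. in $\Omega$. **(2) Property $(\mathcal{D})$.** For all $b\in(0,1)$, $M>0$, $\mu_-,\lambda_-\in\mathbb{R}$ and $\Gamma$ there is a constant $\tau\in(0,1)$, depending only on $N,p,s,C_1,C_2,b,M,\mu_-,\lambda_-$ and $\Gamma$, such that the following holds for all $\Omega,g,H,\varepsilon,u$ as above with $|g|\le\Gamma$ a.e. in $\Omega$ and $u\ge\lambda_-$ a.e. in $\mathbb{R}^N$: whenever $0<r\le1$, $B_r(y)\Subset\Omega$, $u\ge\mu_-$ a.e. in $B_r(y)$ and $$|\{u\le\mu_-+M\}\cap B_r(y)|\le\tau|B_r(y)| ,$$ then $u\ge\mu_-+bM$ a.e. in $B_{3r/4}(y)$. -/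

import Mathlib

open Real Set Filter Topology MeasureTheory
open scoped ENNReal ContDiff

namespace MixedAnisotropic

/-- The Euclidean space `ℝ^N`. -/
abbrev Space (N : ℕ) : Type := EuclideanSpace ℝ (Fin N)

/-- `H` is a Finsler-Minkowski norm on `ℝ^N` with ellipticity constants `C₁, C₂ > 0`.
Since `H` is positively homogeneous, it is linear on rays; as usual for norms, strict convexity
means the strict convexity inequality for any two vectors that do not lie on a common ray
(which, with homogeneity, implies that `H` is convex). -/
structure IsFinslerMinkowski {N : ℕ} (C₁ C₂ : ℝ) (H : Space N → ℝ) : Prop where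
  strictConvex : ∀ x y : Space N, ¬ SameRay ℝ x y → ∀ a b : ℝ, 0 < a → 0 < b → a + b = 1 →
    H (a • x + b • y) < a * H x + b * H y
  contDiffOn : ContDiffOn ℝ 1 H {0}ᶜ
  eq_zero_iff : ∀ x, H x = 0 ↔ x = 0
  homogeneous : ∀ (t : ℝ) (x : Space N), H (t • x) = |t| * H x
  lower_pos : 0 < C₁
  upper_pos : 0 < C₂
  lower_bound : ∀ x, C₁ * ‖x‖ ≤ H x
  upper_bound : ∀ x, H x ≤ C₂ * ‖x‖

/-- `G` is a weak (distributional) gradient of `u` in the open set `Ω`. -/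
def HasWeakGradient {N : ℕ} (Ω : Set (Space N)) (u : Space N → ℝ) (G : Space N → Space N) : Prop :=
  LocallyIntegrableOn u Ω ∧ LocallyIntegrableOn G Ω ∧
    ∀ η : Space N → ℝ, ContDiff ℝ ∞ η → HasCompactSupport η → tsupport η ⊆ Ω →
      ∫ x in Ω, u x • gradient η x = - ∫ x in Ω, η x • G x

/-- `u ∈ W^{1,p}_loc(Ω)`, with weak gradient `G`. -/
def MemW1pLoc {N : ℕ} (p : ℝ) (Ω : Set (Space N)) (u : Space N → ℝ) (G : Space N → Space N) :
    Prop :=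
  HasWeakGradient Ω u G ∧
    ∀ K : Set (Space N), IsCompact K → K ⊆ Ω →
      MemLp u (ENNReal.ofReal p) (volume.restrict K) ∧
      MemLp G (ENNReal.ofReal p) (volume.restrict K)

/-- `φ ∈ W_0^{1,p}(Ω') = {φ ∈ W^{1,p}(ℝ^N) : φ = 0 a.e. in ℝ^N \ Ω'}`, with weak gradient `Φ`. -/
def MemW1pZero {N : ℕ} (p : ℝ) (Ω' : Set (Space N)) (φ : Space N → ℝ) (Φ : Space N → Space N) :
    Prop :=
  HasWeakGradient univ φ Φ ∧ MemLp φ (ENNReal.ofReal p) volume ∧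
    MemLp Φ (ENNReal.ofReal p) volume ∧ ∀ᵐ x, x ∉ Ω' → φ x = 0

/-- The tail space `L^{ps}_{p-1}(ℝ^N)`. -/
def MemTailSpace {N : ℕ} (p s : ℝ) (u : Space N → ℝ) : Prop :=
  AEStronglyMeasurable u volume ∧ LocallyIntegrable (fun y => |u y| ^ (p - 1)) volume ∧
    Integrable (fun y => |u y| ^ (p - 1) / (1 + ‖y‖) ^ ((N : ℝ) + p * s)) volume

/-- The local form `∫_{Ω'} H(∇u)^{p-1} ∇H(∇u) · ∇φ dx`, where `G = ∇u` and `Φ = ∇φ`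
(the integrand is `0` where `∇u = 0`, because `H 0 = 0` and `p > 1`). -/
noncomputable def localForm {N : ℕ} (p : ℝ) (H : Space N → ℝ) (Ω' : Set (Space N))
    (G Φ : Space N → Space N) : ℝ :=
  ∫ x in Ω', H (G x) ^ (p - 1) * inner ℝ (gradient H (G x)) (Φ x)

/-- The nonlocal form
`∬ |u(x)-u(y)|^{p-2} (u(x)-u(y)) (φ(x)-φ(y)) |x-y|^{-N-ps} dx dy` over `ℝ^N × ℝ^N`. -/
noncomputable def nonlocalForm {N : ℕ} (p s : ℝ) (u φ : Space N → ℝ) : ℝ :=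
  ∫ z : Space N × Space N,
    |u z.1 - u z.2| ^ (p - 2) * (u z.1 - u z.2) * (φ z.1 - φ z.2) *
      ‖z.1 - z.2‖ ^ (-((N : ℝ) + p * s))

/-- `u ∈ W^{1,p}_loc(Ω) ∩ L^{ps}_{p-1}(ℝ^N)` is a weak supersolution in `Ω` of
`-H_p u + ε (-Δ_p)^s u = g |u|^{p-2} u`. -/
def IsWeakSupersolution {N : ℕ} (p s ε : ℝ) (H : Space N → ℝ) (g : Space N → ℝ)
    (Ω : Set (Space N)) (u : Space N → ℝ) : Prop :=
  MemTailSpace p s u ∧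
  ∃ G : Space N → Space N, MemW1pLoc p Ω u G ∧
    ∀ Ω' : Set (Space N), IsOpen Ω' → IsCompact (closure Ω') → closure Ω' ⊆ Ω →
      ∀ (φ : Space N → ℝ) (Φ : Space N → Space N), MemW1pZero p Ω' φ Φ → (∀ᵐ x, 0 ≤ φ x) →
        0 ≤ localForm p H Ω' G Φ + ε * nonlocalForm p s u φ
          - ∫ x in Ω', g x * |u x| ^ (p - 2) * u x * φ x

/-- The set of Lebesgue points of `u` in `Ω`. -/
def lebesguePoints {N : ℕ} (Ω : Set (Space N)) (u : Space N → ℝ) : Set (Space N) :=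
  {x | x ∈ Ω ∧ Tendsto (fun r : ℝ => ⨍ y in Metric.ball x r, |u x - u y|) (𝓝[>] 0) (𝓝 0)}

/-- The essential infimum of `u` over the ball `B_r(x)`, as an extended real number. -/
noncomputable def essInfBall {N : ℕ} (u : Space N → ℝ) (x : Space N) (r : ℝ) : EReal :=
  essInf (fun y => (u y : EReal)) (volume.restrict (Metric.ball x r))

/-- The lower semicontinuous regularization `u_*(x) = lim_{r → 0+} ess inf_{B_r(x)} u`, with values
in the extended reals (the limit may be `+∞`; it always exists, see `tendsto_lscRegularization`). -/
noncomputable def lscRegularization {N : ℕ} (u : Space N → ℝ) (x : Space N) : EReal :=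
  limUnder (𝓝[>] (0 : ℝ)) (essInfBall u x)

theorem essInfBall_antitone {N : ℕ} (u : Space N → ℝ) (x : Space N) :
    Antitone (essInfBall u x) := fun _ _ h =>
  essInf_antitone_measure
    (Measure.restrict_mono (Metric.ball_subset_ball h) le_rfl).absolutelyContinuous

theorem tendsto_lscRegularization {N : ℕ} (u : Space N → ℝ) (x : Space N) :
    Tendsto (essInfBall u x) (𝓝[>] 0) (𝓝 (lscRegularization u x)) :=
  tendsto_nhds_limUnder ⟨_, (essInfBall_antitone u x).tendsto_nhdsGT 0⟩

/-- The measure-to-pointwise property of De Giorgi type, with parameters `b, c, M, μ` and `τ`: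
if `u ≥ μ` in a ball `B_r(y) ⋐ Ω` with `r ≤ 1` and `u ≤ μ + M` holds at most on a fraction `τ` of
this ball, then `u ≥ μ + b M` in `B_{cr}(y)`. -/
def DeGiorgiProperty {N : ℕ} (Ω : Set (Space N)) (u : Space N → ℝ) (b c M μ τ : ℝ) : Prop :=
  ∀ (y : Space N) (r : ℝ), 0 < r → r ≤ 1 → Metric.closedBall y r ⊆ Ω →
    (∀ᵐ x ∂volume.restrict (Metric.ball y r), μ ≤ u x) →
    volume ({x | u x ≤ μ + M} ∩ Metric.ball y r)
      ≤ ENNReal.ofReal τ * volume (Metric.ball y r) →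
    ∀ᵐ x ∂volume.restrict (Metric.ball y (c * r)), μ + b * M ≤ u x

end MixedAnisotropic

/-!
Both parts follow from a De Giorgi iteration for the sublevel sets of a supersolution `u`.

*Energy estimate.* Since `u` is bounded below by `lam` in the whole space, all truncations
`(k - u)⁺` at levels `k ≤ μ + M` are bounded by the constant `K = |lam| + |μ| + M`. The weak
inequality is tested with `(k - u)⁺ η ^ m`, where `η` is a smooth cutoff function with gradient
bounded by `Λ ≥ 1` and `m ≥ p` is an integer. The local term gives the weighted energy of `∇u` on
`{u < k}` up to an error `Λ ^ p |E|`, where `E = {u < k, η ≠ 0}` carries the test function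
(`local_integrand_le`, from Euler's identity for `H` and Young's inequality). The nonlocal term is
at most a multiple of `Λ ^ p |E|`: its integrand has a pointwise bound by `|η x - η y| ^ p`
(`nonlocal_integrand_le`), vanishes unless `x ∈ E` or `y ∈ E`, and `min 1 |z| ^ p |z| ^ (-N - p s)`
is integrable. No tail of `u` appears because `(k - u)⁺` is bounded everywhere. The
right-hand side is bounded on `{u < k}`. The outcome is `caccioppoli`.

*Gain of measure.* Consequently `‖∇((k - u)⁺ η ^ m)‖₁ ≤ C Λ |E|` (`lintegral_testGrad_le`), and
Sobolev's inequality in `W^{1,1}` with Chebyshev's inequality bounds the measure of a smaller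
sublevel set by a power `N / (N - 1) > 1` of that of a larger one (`measureReal_sublevel_le`). The
resulting recursion is invariant under scaling of the radius `r ≤ 1` and has superlinear growth, so
it tends to zero if it starts small (`exists_tendsto_zero_of_le_rpow`). This is property `(𝒟)`,
`exists_deGiorgiProperty`.

*Sobolev calculus.* The weak gradients of products and truncations, and Sobolev's inequality for
`W^{1,1}`, come from mollification: mollifying commutes with weak gradients
(`hasGradientAt_mollify`) and converges almost everywhere and in `L¹`.

*Semicontinuity.* At a Lebesgue point `u_* ≤ u`, since an essential infimum does not exceed a mean
value. If `u_* x < c < t < u x`, then `{u ≤ t}` has density zero at `x`, and property `(𝒟)`, with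
`μ + M = t` and `μ + b M = c`, forces `u ≥ c` near `x`: a contradiction. As a supremum of essential
infima over shrinking balls, `u_*` is lower semicontinuous for every function `u`.
-/

namespace MixedAnisotropic

/-! ### Finsler-Minkowski norms -/

namespace IsFinslerMinkowski

variable {N : ℕ} {C₁ C₂ : ℝ} {H : Space N → ℝ}

lemma nonneg (hH : IsFinslerMinkowski C₁ C₂ H) (x : Space N) : 0 ≤ H x :=
  (mul_nonneg hH.lower_pos.le (norm_nonneg x)).trans (hH.lower_bound x)

lemma map_zero (hH : IsFinslerMinkowski C₁ C₂ H) : H 0 = 0 := (hH.eq_zero_iff 0).2 rfl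

lemma add_le (hH : IsFinslerMinkowski C₁ C₂ H) (x y : Space N) : H (x + y) ≤ H x + H y := by
  by_cases hxy : SameRay ℝ x y
  · obtain rfl | rfl | ⟨a, b, ha, hb, hab⟩ := hxy
    · simp [hH.map_zero]
    · simp [hH.map_zero]
    · have hy : y = (b⁻¹ * a) • x := by
        rw [mul_smul, hab, smul_smul, inv_mul_cancel₀ hb.ne', one_smul]
      have hc : 0 ≤ b⁻¹ * a := by positivity
      have : x + y = (1 + b⁻¹ * a) • x := by rw [hy, add_smul, one_smul]
      rw [this, hy, hH.homogeneous, hH.homogeneous, abs_of_nonneg hc, abs_of_nonneg (by positivity)]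
      linarith
  · have h := hH.strictConvex x y hxy (1 / 2) (1 / 2) (by norm_num) (by norm_num) (by norm_num)
    have h2 : x + y = (2 : ℝ) • ((1 / 2 : ℝ) • x + (1 / 2 : ℝ) • y) := by
      rw [smul_add, smul_smul, smul_smul]; norm_num
    rw [h2, hH.homogeneous, abs_of_pos two_pos]
    linarith

lemma lipschitzWith (hH : IsFinslerMinkowski C₁ C₂ H) : LipschitzWith C₂.toNNReal H := by
  refine LipschitzWith.of_le_add_mul _ fun x y => ?_
  have h := hH.add_le y (x - y)
  rw [add_sub_cancel] at h
  rw [Real.coe_toNNReal _ hH.upper_pos.le, dist_eq_norm]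
  linarith [hH.upper_bound (x - y)]

lemma abs_inner_gradient_le (hH : IsFinslerMinkowski C₁ C₂ H) (x v : Space N) :
    |inner ℝ (gradient H x) v| ≤ C₂ * ‖v‖ := by
  refine (abs_real_inner_le_norm _ _).trans (mul_le_mul_of_nonneg_right ?_ (norm_nonneg v))
  have h := norm_fderiv_le_of_lipschitz ℝ hH.lipschitzWith (x₀ := x)
  rw [Real.coe_toNNReal _ hH.upper_pos.le] at h
  simpa [gradient] using h

/-- Euler's identity for the positively one-homogeneous function `H`. -/
lemma inner_gradient_self (hH : IsFinslerMinkowski C₁ C₂ H) {x : Space N} (hx : x ≠ 0) :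
    inner ℝ (gradient H x) x = H x := by
  have hd : DifferentiableAt ℝ H x :=
    (hH.contDiffOn.differentiableOn one_ne_zero).differentiableAt
      (isOpen_compl_singleton.mem_nhds hx)
  have h1 : HasDerivAt (fun t : ℝ => H (t • x)) (inner ℝ (gradient H x) x) 1 := by
    have hl : HasDerivAt (fun t : ℝ => t • x) x 1 := by
      simpa using (hasDerivAt_id (1 : ℝ)).smul_const x
    have hf : HasFDerivAt H (fderiv ℝ H x) ((1 : ℝ) • x) := by simpa using hd.hasFDerivAt
    have := hf.comp_hasDerivAt (1 : ℝ) hl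
    simpa [gradient, Function.comp_def] using this
  have h2 : HasDerivAt (fun t : ℝ => H (t • x)) (H x) 1 := by
    have hl : HasDerivAt (fun t : ℝ => t * H x) (H x) 1 := by
      simpa using (hasDerivAt_id (1 : ℝ)).mul_const (H x)
    refine hl.congr_of_eventuallyEq ?_
    filter_upwards [lt_mem_nhds (zero_lt_one' ℝ)] with t ht
    rw [hH.homogeneous, abs_of_pos ht]
  exact h1.unique h2

lemma rpow_mul_inner_gradient_self (hH : IsFinslerMinkowski C₁ C₂ H) {p : ℝ} (hp : 1 < p)
    (x : Space N) : H x ^ (p - 1) * inner ℝ (gradient H x) x = H x ^ p := by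
  rcases eq_or_ne x 0 with rfl | hx
  · rw [hH.map_zero, Real.zero_rpow (by linarith), Real.zero_rpow (by linarith), zero_mul]
  · have hpos : 0 < H x := (hH.nonneg x).lt_of_ne fun h => hx ((hH.eq_zero_iff x).1 h.symm)
    rw [hH.inner_gradient_self hx, ← Real.rpow_add_one hpos.ne', sub_add_cancel]

end IsFinslerMinkowski

/-! ### Pointwise inequalities for truncated test functions -/

/-- A form of Young's inequality with a cutoff weight `a ^ m`, `m ≥ p`: the term with the factor
`X ^ (p - 1)` is absorbed by the one with `X ^ p`. -/
lemma pow_mul_rpow_mul_sub_le {p : ℝ} (hp : 1 < p) {m : ℕ} (hm : p ≤ m) {a X D : ℝ}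
    (ha₀ : 0 ≤ a) (ha₁ : a ≤ 1) (hX : 0 ≤ X) (hD : 0 ≤ D) :
    a ^ (m - 1) * X ^ (p - 1) * (D - a * X) ≤ D ^ p := by
  rcases le_or_gt D (a * X) with h | h
  · exact (mul_nonpos_of_nonneg_of_nonpos (by positivity) (by linarith)).trans (by positivity)
  · have hD' : 0 < D := lt_of_le_of_lt (by positivity) h
    have hm1 : (1 : ℝ) ≤ m := by linarith
    have hcast : ((m - 1 : ℕ) : ℝ) = m - 1 := by
      rw [Nat.cast_sub (by exact_mod_cast hm1), Nat.cast_one]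
    have h1 : a ^ (m - 1) ≤ a ^ (p - 1) := by
      rw [← Real.rpow_natCast, hcast]
      rcases ha₀.eq_or_lt with rfl | ha
      · rw [Real.zero_rpow (by linarith), Real.zero_rpow (by linarith)]
      · exact Real.rpow_le_rpow_of_exponent_ge ha ha₁ (by linarith)
    calc a ^ (m - 1) * X ^ (p - 1) * (D - a * X)
        ≤ a ^ (p - 1) * X ^ (p - 1) * D := by
          gcongr
          nlinarith [mul_nonneg ha₀ hX]
      _ = (a * X) ^ (p - 1) * D := by rw [Real.mul_rpow ha₀ hX]
      _ ≤ D ^ (p - 1) * D := by gcongr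
      _ = D ^ p := by rw [← Real.rpow_add_one hD'.ne', sub_add_cancel]

/-- For weights `a ≤ b`, the bad term of the nonlocal form is absorbed by the good one, up to a
power of `b - a`. If `b ≤ 2 a` this is Young's inequality; otherwise `b ≤ 2 (b - a)`. -/
lemma rpow_mul_pow_sub_pow_le {p : ℝ} (hp : 1 < p) {m : ℕ} (hm : p ≤ m) {L T c a b : ℝ}
    (hT₀ : 0 ≤ T) (hT : T ≤ L) (hc : c ≤ L) (ha₀ : 0 ≤ a) (hab : a ≤ b)
    (hb₁ : b ≤ 1) :
    T ^ (p - 1) * (c * (b ^ m - a ^ m) - T * a ^ m) ≤ (m * 2 ^ m * L * (b - a)) ^ p := by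
  have hL : 0 ≤ L := hT₀.trans hT
  have hm1 : (1 : ℝ) ≤ m := by linarith
  have hm0 : m ≠ 0 := by rintro rfl; norm_num at hm1
  have hpow : b ^ m - a ^ m ≤ m * b ^ (m - 1) * (b - a) := by
    obtain ⟨n, rfl⟩ := Nat.exists_eq_succ_of_ne_zero hm0
    have := sub_nonneg.2 hab
    rw [← Commute.geom_sum₂_mul (Commute.all b a)]
    refine mul_le_mul_of_nonneg_right ?_ this
    calc ∑ i ∈ Finset.range n.succ, b ^ i * a ^ (n.succ - 1 - i)
        ≤ ∑ i ∈ Finset.range n.succ, b ^ n := by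
          refine Finset.sum_le_sum fun i hi => ?_
          have hi' : i ≤ n := Nat.lt_succ_iff.1 (Finset.mem_range.1 hi)
          calc b ^ i * a ^ (n.succ - 1 - i) ≤ b ^ i * b ^ (n - i) := by
                have : 0 ≤ b := ha₀.trans hab
                simp only [Nat.succ_eq_add_one, Nat.add_sub_cancel]
                gcongr
            _ = b ^ n := by rw [← pow_add, Nat.add_sub_cancel' hi']
      _ = _ := by simp
  rcases le_or_gt b (2 * a) with h | h
  · -- comparable weights: the good term absorbs the bad one
    set D := m * 2 ^ m * L * (b - a) with hDdef
    have hD : 0 ≤ D := mul_nonneg (by positivity) (sub_nonneg.2 hab)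
    have h1 : c * (b ^ m - a ^ m) ≤ a ^ (m - 1) * D := by
      have hb : b ^ (m - 1) ≤ 2 ^ m * a ^ (m - 1) := by
        calc b ^ (m - 1) ≤ (2 * a) ^ (m - 1) := by gcongr; linarith
          _ = 2 ^ (m - 1) * a ^ (m - 1) := mul_pow ..
          _ ≤ 2 ^ m * a ^ (m - 1) := by gcongr <;> norm_num
      have hba := sub_nonneg.2 hab
      calc c * (b ^ m - a ^ m) ≤ L * (m * b ^ (m - 1) * (b - a)) := by
            refine mul_le_mul hc hpow ?_ hL
            exact sub_nonneg.2 (pow_le_pow_left₀ ha₀ hab m)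
        _ ≤ L * (m * (2 ^ m * a ^ (m - 1)) * (b - a)) := by gcongr
        _ = a ^ (m - 1) * D := by rw [hDdef]; ring
    have h2 : a ^ m = a ^ (m - 1) * a := by rw [← pow_succ, Nat.sub_add_cancel (by omega)]
    calc T ^ (p - 1) * (c * (b ^ m - a ^ m) - T * a ^ m)
        ≤ T ^ (p - 1) * (a ^ (m - 1) * D - T * a ^ m) := by gcongr
      _ = a ^ (m - 1) * T ^ (p - 1) * (D - a * T) := by rw [h2]; ring
      _ ≤ D ^ p := pow_mul_rpow_mul_sub_le hp hm ha₀ (hab.trans hb₁) hT₀ hD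
  · -- the larger weight is controlled by the difference of the weights
    have hb0 : 0 ≤ b := ha₀.trans hab
    have hba : b ≤ 2 * (b - a) := by linarith
    have h0 : b ^ m - a ^ m ≤ b ^ p := by
      have : b ^ m ≤ b ^ p := by
        rw [← Real.rpow_natCast]
        rcases hb0.eq_or_lt with rfl | hb
        · rw [Real.zero_rpow (by linarith), Real.zero_rpow (by linarith)]
        · exact Real.rpow_le_rpow_of_exponent_ge hb hb₁ hm
      linarith [pow_nonneg ha₀ m]
    have hLp : L ^ (p - 1) * L = L ^ p := by
      rcases hL.eq_or_lt with rfl | h'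
      · rw [Real.zero_rpow (by linarith), mul_zero, Real.zero_rpow (by linarith)]
      · rw [← Real.rpow_add_one h'.ne', sub_add_cancel]
    calc T ^ (p - 1) * (c * (b ^ m - a ^ m) - T * a ^ m)
        ≤ L ^ (p - 1) * (L * b ^ p) := by
          have h3 : c * (b ^ m - a ^ m) - T * a ^ m ≤ L * b ^ p := by
            have h4 : c * (b ^ m - a ^ m) ≤ L * b ^ p :=
              mul_le_mul hc h0 (sub_nonneg.2 (pow_le_pow_left₀ ha₀ hab m)) hL
            have : 0 ≤ T * a ^ m := by positivity
            linarith
          calc _ ≤ T ^ (p - 1) * (L * b ^ p) := by gcongr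
            _ ≤ _ := by gcongr
      _ = L ^ p * b ^ p := by rw [← hLp]; ring
      _ ≤ L ^ p * (2 * (b - a)) ^ p := by gcongr
      _ = (2 * L * (b - a)) ^ p := by
          rw [← Real.mul_rpow hL (by linarith)]; ring_nf
      _ ≤ (m * 2 ^ m * L * (b - a)) ^ p := by
          have := sub_nonneg.2 hab
          have h2 : (2 : ℝ) ≤ m * 2 ^ m := by
            calc (2 : ℝ) = 1 * 2 ^ 1 := by norm_num
              _ ≤ m * 2 ^ m := by gcongr; exacts [one_le_two, Nat.one_le_iff_ne_zero.2 hm0]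
          gcongr

/-- The pointwise bound behind the nonlocal Caccioppoli estimate: the integrand of the nonlocal
form, tested with `(k - u)⁺ η ^ m`, is bounded above by the difference of the cutoff function. -/
lemma nonlocal_integrand_le {p : ℝ} (hp : 1 < p) {m : ℕ} (hm : p ≤ m) {L k u₁ u₂ a b : ℝ}
    (hL : 0 ≤ L) (hu₁ : k - u₁ ≤ L) (hu₂ : k - u₂ ≤ L) (ha₀ : 0 ≤ a) (ha₁ : a ≤ 1) (hb₀ : 0 ≤ b)
    (hb₁ : b ≤ 1) :
    |u₁ - u₂| ^ (p - 2) * (u₁ - u₂) * (max (k - u₁) 0 * a ^ m - max (k - u₂) 0 * b ^ m)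
      ≤ (m * 2 ^ m * L * |a - b|) ^ p := by
  wlog h : u₁ ≤ u₂ generalizing u₁ u₂ a b
  · have := this hu₂ hu₁ hb₀ hb₁ ha₀ ha₁ (le_of_not_ge h)
    rw [abs_sub_comm u₂ u₁, abs_sub_comm b a] at this
    linarith
  have hR : 0 ≤ (m * 2 ^ m * L * |a - b|) ^ p := by positivity
  obtain ⟨T, rfl⟩ : ∃ T, u₂ = u₁ + T := ⟨u₂ - u₁, by ring⟩
  have hT : 0 ≤ T := by linarith
  have hpw : |u₁ - (u₁ + T)| ^ (p - 2) * (u₁ - (u₁ + T)) = - T ^ (p - 1) := by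
    have : u₁ - (u₁ + T) = -T := by ring
    rw [this, abs_neg, abs_of_nonneg hT]
    rcases hT.eq_or_lt with rfl | hT'
    · rw [neg_zero, mul_zero, Real.zero_rpow (by linarith), neg_zero]
    · have : p - 1 = p - 2 + 1 := by ring
      rw [this, Real.rpow_add_one hT'.ne']; ring
  rw [hpw]
  have hTp : 0 ≤ T ^ (p - 1) := by positivity
  rcases le_or_gt (k - (u₁ + T)) 0 with hk | hk
  · rw [max_eq_right hk, zero_mul, sub_zero]
    have : 0 ≤ max (k - u₁) 0 * a ^ m := by positivity
    nlinarith
  · rw [max_eq_left hk.le, max_eq_left (by linarith)]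
    rcases le_or_gt b a with hba | hab
    · have : (k - (u₁ + T)) * b ^ m ≤ (k - u₁) * a ^ m := by
        have := pow_le_pow_left₀ hb₀ hba m
        refine mul_le_mul (by linarith) this (by positivity) (by linarith)
      nlinarith
    · have := rpow_mul_pow_sub_pow_le hp hm hT (L := L) (T := T) (by linarith) hu₂ ha₀ hab.le
        hb₁
      rw [abs_sub_comm, abs_of_pos (sub_pos.2 hab)]
      refine le_trans (le_of_eq ?_) this
      ring

/-! ### Mollification -/

section Mollification

open scoped Convolution
open ContinuousLinearMap

variable {N : ℕ} {F : Type*} [NormedAddCommGroup F] [NormedSpace ℝ F]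

/-- The mollification of `f` with the normalized bump function `φ`. -/
noncomputable def mollify (φ : ContDiffBump (0 : Space N)) (f : Space N → F) : Space N → F :=
  φ.normed volume ⋆[lsmul ℝ ℝ, volume] f

lemma mollify_apply (φ : ContDiffBump (0 : Space N)) (f : Space N → F) (x : Space N) :
    mollify φ f x = ∫ t, φ.normed volume (x - t) • f t := convolution_lsmul_swap

lemma contDiff_mollify [CompleteSpace F] (φ : ContDiffBump (0 : Space N)) {f : Space N → F}
    (hf : LocallyIntegrable f) : ContDiff ℝ ∞ (mollify φ f) :=
  φ.hasCompactSupport_normed.contDiff_convolution_left _ φ.contDiff_normed hf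

/-- Mollification does not increase the `L¹` norm. -/
lemma lintegral_enorm_mollify_le (φ : ContDiffBump (0 : Space N)) {f : Space N → F}
    (hf : AEStronglyMeasurable f volume) :
    ∫⁻ x, ‖mollify φ f x‖ₑ ≤ ∫⁻ x, ‖f x‖ₑ := by
  have hφ : AEStronglyMeasurable (φ.normed volume) (volume : Measure (Space N)) :=
    φ.continuous_normed.aestronglyMeasurable
  calc ∫⁻ x, ‖mollify φ f x‖ₑ
      ≤ ∫⁻ x, ∫⁻ t, ‖(lsmul ℝ ℝ) (φ.normed volume t) (f (x - t))‖ₑ :=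
        lintegral_mono fun x => enorm_integral_le_lintegral_enorm _
    _ = ∫⁻ t, ∫⁻ x, ‖(lsmul ℝ ℝ) (φ.normed volume t) (f (x - t))‖ₑ := by
        refine lintegral_lintegral_swap ?_
        exact (AEStronglyMeasurable.convolution_integrand (lsmul ℝ ℝ) hφ hf).enorm
    _ = ∫⁻ t, ‖φ.normed volume t‖ₑ * ∫⁻ x, ‖f x‖ₑ := by
        refine lintegral_congr fun t => ?_
        simp_rw [lsmul_apply, enorm_smul]
        rw [lintegral_const_mul' _ _ enorm_ne_top,
          lintegral_sub_right_eq_self (fun x => ‖f x‖ₑ) t]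
    _ = (∫⁻ t, ‖φ.normed volume t‖ₑ) * ∫⁻ x, ‖f x‖ₑ :=
        lintegral_mul_const'' _ hφ.enorm
    _ = ∫⁻ x, ‖f x‖ₑ := by
        have h1 : ∫⁻ t, ‖φ.normed volume t‖ₑ = 1 := by
          have h := ofReal_integral_eq_lintegral_ofReal (φ.integrable_normed (μ := volume))
            (Eventually.of_forall fun t => φ.nonneg_normed t)
          rw [φ.integral_normed, ENNReal.ofReal_one] at h
          rw [h]
          exact lintegral_congr fun t => Real.enorm_of_nonneg (φ.nonneg_normed t)
        rw [h1, one_mul]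

/-- A Scheffé-Riesz lemma: almost everywhere convergence without increase of the `L¹` norms implies
convergence in `L¹`. It is Fatou's lemma for `‖f n‖ + ‖g‖ - ‖f n - g‖ ≥ 0`. -/
lemma tendsto_lintegral_enorm_sub {α X : Type*} [MeasurableSpace α] {μ : Measure α}
    [NormedAddCommGroup X] {f : ℕ → α → X} {g : α → X}
    (hf : ∀ n, AEStronglyMeasurable (f n) μ) (hg : Integrable g μ)
    (hlim : ∀ᵐ x ∂μ, Tendsto (fun n => f n x) atTop (𝓝 (g x)))
    (hle : ∀ n, ∫⁻ x, ‖f n x‖ₑ ∂μ ≤ ∫⁻ x, ‖g x‖ₑ ∂μ) :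
    Tendsto (fun n => ∫⁻ x, ‖f n x - g x‖ₑ ∂μ) atTop (𝓝 0) := by
  set I := ∫⁻ x, ‖g x‖ₑ ∂μ with hI
  have hItop : I ≠ ⊤ := hg.2.ne
  set h : ℕ → α → ℝ≥0∞ := fun n x => ‖f n x‖ₑ + ‖g x‖ₑ - ‖f n x - g x‖ₑ with hh
  have hmeas : ∀ n, AEMeasurable (h n) μ := fun n =>
    ((hf n).enorm.add hg.1.enorm).sub ((hf n).sub hg.1).enorm
  have hfat : I + I ≤ liminf (fun n => ∫⁻ x, h n x ∂μ) atTop := by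
    calc I + I = ∫⁻ x, liminf (fun n => h n x) atTop ∂μ := by
          rw [hI, ← lintegral_add_left' hg.1.enorm]
          refine lintegral_congr_ae ?_
          filter_upwards [hlim] with x hx
          refine (Tendsto.liminf_eq ?_).symm
          have h1 : Tendsto (fun n => ‖f n x - g x‖ₑ) atTop (𝓝 0) := by
            simpa using (hx.sub_const (g x)).enorm
          have h2 := ENNReal.Tendsto.sub (hx.enorm.add_const ‖g x‖ₑ) h1
            (Or.inr ENNReal.zero_ne_top)
          simpa using h2
      _ ≤ _ := lintegral_liminf_le' hmeas
  have hsum : ∀ n, ∫⁻ x, ‖f n x - g x‖ₑ ∂μ ≤ I + I - ∫⁻ x, h n x ∂μ := by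
    intro n
    have hsum' : ∫⁻ x, ‖f n x - g x‖ₑ ∂μ + ∫⁻ x, h n x ∂μ ≤ I + I := by
      rw [← lintegral_add_left' (f := fun x => ‖f n x - g x‖ₑ) ((hf n).sub hg.1).enorm]
      calc ∫⁻ x, ‖f n x - g x‖ₑ + h n x ∂μ = ∫⁻ x, ‖f n x‖ₑ + ‖g x‖ₑ ∂μ := by
            refine lintegral_congr fun x => ?_
            rw [hh]
            exact add_tsub_cancel_of_le enorm_sub_le
        _ = ∫⁻ x, ‖f n x‖ₑ ∂μ + I := lintegral_add_left' (hf n).enorm _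
        _ ≤ I + I := add_le_add_left (hle n) _
    have hfin : ∫⁻ x, h n x ∂μ ≠ ⊤ :=
      ne_top_of_le_ne_top (ENNReal.add_ne_top.2 ⟨hItop, hItop⟩) (le_add_self.trans hsum')
    exact ENNReal.le_sub_of_add_le_right hfin hsum'
  refine tendsto_of_le_liminf_of_limsup_le (by simp) ?_
  calc limsup (fun n => ∫⁻ x, ‖f n x - g x‖ₑ ∂μ) atTop
      ≤ limsup (fun n => I + I - ∫⁻ x, h n x ∂μ) atTop :=
        limsup_le_limsup (Eventually.of_forall hsum)
    _ = I + I - liminf (fun n => ∫⁻ x, h n x ∂μ) atTop :=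
        ENNReal.limsup_const_sub _ _ (ENNReal.add_ne_top.2 ⟨hItop, hItop⟩)
    _ ≤ 0 := by rw [tsub_eq_zero_of_le hfat]

/-- A sequence of bump functions shrinking to the origin. -/
noncomputable def bumpSeq (N n : ℕ) : ContDiffBump (0 : Space N) where
  rIn := 1 / ((n : ℝ) + 1)
  rOut := 2 * (1 / ((n : ℝ) + 1))
  rIn_pos := by positivity
  rIn_lt_rOut := by
    have : (0 : ℝ) < 1 / ((n : ℝ) + 1) := by positivity
    linarith

lemma ae_tendsto_mollify [CompleteSpace F] {f : Space N → F} (hf : LocallyIntegrable f) :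
    ∀ᵐ x, Tendsto (fun n => mollify (bumpSeq N n) f x) atTop (𝓝 (f x)) := by
  refine ContDiffBump.ae_convolution_tendsto_right_of_locallyIntegrable (K := 2) ?_ ?_ hf
  · simpa [bumpSeq] using (tendsto_one_div_add_atTop_nhds_zero_nat (𝕜 := ℝ)).const_mul 2
  · exact Eventually.of_forall fun n => le_rfl

lemma tendsto_lintegral_mollify_sub [CompleteSpace F] {f : Space N → F} (hf : Integrable f) :
    Tendsto (fun n => ∫⁻ x, ‖mollify (bumpSeq N n) f x - f x‖ₑ) atTop (𝓝 0) :=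
  tendsto_lintegral_enorm_sub
    (fun _ => (contDiff_mollify _ hf.locallyIntegrable).continuous.aestronglyMeasurable) hf
    (ae_tendsto_mollify hf.locallyIntegrable)
    (fun _ => lintegral_enorm_mollify_le _ hf.1)

lemma integrable_mollify [CompleteSpace F] (φ : ContDiffBump (0 : Space N)) {f : Space N → F}
    (hf : Integrable f) : Integrable (mollify φ f) :=
  ⟨(contDiff_mollify _ hf.locallyIntegrable).continuous.aestronglyMeasurable,
    (lintegral_enorm_mollify_le φ hf.1).trans_lt hf.2⟩

lemma inner_gradient (f : Space N → ℝ) (x h : Space N) :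
    inner ℝ (gradient f x) h = fderiv ℝ f x h := by
  simp [gradient]

lemma norm_gradient (f : Space N → ℝ) (x : Space N) : ‖gradient f x‖ = ‖fderiv ℝ f x‖ := by
  simp [gradient]

lemma continuous_gradient {f : Space N → ℝ} (hf : ContDiff ℝ ∞ f) : Continuous (gradient f) :=
  (InnerProductSpace.toDual ℝ (Space N)).symm.continuous.comp (hf.continuous_fderiv (by simp))

lemma hasCompactSupport_gradient {f : Space N → ℝ} (hf : HasCompactSupport f) :
    HasCompactSupport (gradient f) :=
  (hf.fderiv ℝ).comp_left (map_zero (InnerProductSpace.toDual ℝ (Space N)).symm)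

/-- The gradient of the mollification is the mollification of the weak gradient. -/
lemma hasGradientAt_mollify (φ : ContDiffBump (0 : Space N)) {v : Space N → ℝ}
    {V : Space N → Space N} (hv : HasWeakGradient univ v V) (x : Space N) :
    HasGradientAt (mollify φ v) (mollify φ V x) x := by
  obtain ⟨hv1, hV1, hw⟩ := hv
  rw [locallyIntegrableOn_univ] at hv1 hV1
  set ρ := φ.normed (volume : Measure (Space N)) with hρ
  have hρc : ContDiff ℝ ∞ ρ := φ.contDiff_normed
  have hρs : HasCompactSupport ρ := φ.hasCompactSupport_normed
  have hD := hρs.hasFDerivAt_convolution_left (lsmul ℝ ℝ) (hρc.of_le (by simp)) hv1 x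
  rw [hasGradientAt_iff_hasFDerivAt]
  refine hD.congr_fderiv (ContinuousLinearMap.ext fun h => ?_).symm
  -- the weak identity, tested with `t ↦ ρ (x - t)`
  set θ : Space N → ℝ := fun t => ρ (x - t) with hθ
  have hθc : ContDiff ℝ ∞ θ := hρc.comp (contDiff_const.sub contDiff_id)
  have hθs : HasCompactSupport θ := hρs.comp_homeomorph (Homeomorph.subLeft x)
  have hθd : ∀ t, fderiv ℝ θ t h = - fderiv ℝ ρ (x - t) h := by
    intro t
    have h1 : HasFDerivAt θ ((fderiv ℝ ρ (x - t)).comp (-ContinuousLinearMap.id ℝ (Space N))) t :=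
      (((hρc.differentiable (by simp)) (x - t)).hasFDerivAt).comp t
        ((hasFDerivAt_id t).const_sub x)
    rw [h1.fderiv]; simp
  have hid := hw θ hθc hθs (subset_univ _)
  rw [setIntegral_univ, setIntegral_univ] at hid
  have hint1 : Integrable fun t => v t • gradient θ t := by
    have := hv1.integrable_smul_right_of_hasCompactSupport (continuous_gradient hθc)
      (hasCompactSupport_gradient hθs)
    exact this
  have hint2 : Integrable fun t => θ t • V t :=
    hV1.integrable_smul_left_of_hasCompactSupport hθc.continuous hθs
  have hex := (hρs.fderiv ℝ).convolutionExists_left ((lsmul ℝ ℝ).precompL (Space N))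
    (μ := volume) (hρc.continuous_fderiv (by simp)) hv1 x
  have hL : ((fderiv ℝ ρ ⋆[(lsmul ℝ ℝ).precompL (Space N), volume] v) x) h
      = ∫ t, fderiv ℝ ρ (x - t) h * v t := by
    rw [convolution_eq_swap, ContinuousLinearMap.integral_apply]
    · simp [precompL_apply]
    · exact hex.integrable_swap
  rw [hL, InnerProductSpace.toDual_apply_apply, mollify_apply, real_inner_comm,
    ← integral_inner hint2, integral_inner hint2,
    ← neg_eq_iff_eq_neg.2 hid, inner_neg_right, ← integral_inner hint1, ← integral_neg]
  refine integral_congr_ae (Eventually.of_forall fun t => ?_)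
  simp only
  rw [inner_smul_right, real_inner_comm, inner_gradient, hθd]
  ring

end Mollification

/-! ### Weak gradients of products and truncations -/

section WeakGradient

variable {N : ℕ}

/-- The product of a bounded sequence that converges almost everywhere and a sequence that converges
in `L¹`. -/
lemma tendsto_integral_smul {α X : Type*} [MeasurableSpace α] {μ : Measure α}
    [NormedAddCommGroup X] [NormedSpace ℝ X] {g : ℕ → α → ℝ} {g₀ : α → ℝ} {W : ℕ → α → X}
    {W₀ : α → X} {C : ℝ} (hgm : ∀ n, AEStronglyMeasurable (g n) μ) (hb : ∀ n x, |g n x| ≤ C)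
    (hlim : ∀ᵐ x ∂μ, Tendsto (fun n => g n x) atTop (𝓝 (g₀ x))) (hW : ∀ n, Integrable (W n) μ)
    (hW₀ : Integrable W₀ μ) (hL : Tendsto (fun n => ∫⁻ x, ‖W n x - W₀ x‖ₑ ∂μ) atTop (𝓝 0)) :
    Tendsto (fun n => ∫ x, g n x • W n x ∂μ) atTop (𝓝 (∫ x, g₀ x • W₀ x ∂μ)) := by
  have h1 : Tendsto (fun n => ∫ x, g n x • W₀ x ∂μ) atTop (𝓝 (∫ x, g₀ x • W₀ x ∂μ)) := by
    refine tendsto_integral_of_dominated_convergence (fun x => C * ‖W₀ x‖)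
      (fun n => (hgm n).smul hW₀.1) (hW₀.norm.const_mul C)
      (fun n => Eventually.of_forall fun x => ?_) ?_
    · rw [norm_smul]
      exact mul_le_mul_of_nonneg_right (hb n x) (norm_nonneg _)
    · filter_upwards [hlim] with x hx using hx.smul_const _
  have h2 : Tendsto (fun n => ∫ x, g n x • (W n x - W₀ x) ∂μ) atTop (𝓝 0) := by
    rw [tendsto_zero_iff_enorm_tendsto_zero]
    have h3 : Tendsto (fun n => ENNReal.ofReal C * ∫⁻ x, ‖W n x - W₀ x‖ₑ ∂μ) atTop (𝓝 0) := by
      simpa using ENNReal.Tendsto.const_mul hL (Or.inr ENNReal.ofReal_ne_top)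
    refine tendsto_of_tendsto_of_tendsto_of_le_of_le tendsto_const_nhds h3
      (fun _ => zero_le) fun n => ?_
    calc ‖∫ x, g n x • (W n x - W₀ x) ∂μ‖ₑ ≤ ∫⁻ x, ‖g n x • (W n x - W₀ x)‖ₑ ∂μ :=
          enorm_integral_le_lintegral_enorm _
      _ ≤ ∫⁻ x, ENNReal.ofReal C * ‖W n x - W₀ x‖ₑ ∂μ := by
          refine lintegral_mono fun x => ?_
          rw [enorm_smul]
          gcongr
          rw [Real.enorm_eq_ofReal_abs]
          exact ENNReal.ofReal_le_ofReal (hb n x)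
      _ = _ := lintegral_const_mul' _ _ ENNReal.ofReal_ne_top
  have h4 := h2.add h1
  rw [zero_add] at h4
  refine h4.congr fun n => ?_
  have hint : ∀ {Z : α → X}, Integrable Z μ → Integrable (fun x => g n x • Z x) μ := fun hZ =>
    hZ.bdd_smul C (hgm n) (Eventually.of_forall (hb n))
  have h5 : Integrable (fun x => g n x • (W n x - W₀ x)) μ := hint ((hW n).sub hW₀)
  rw [← integral_add h5 (hint hW₀)]
  refine integral_congr_ae (Eventually.of_forall fun x => ?_)
  simp only
  rw [← smul_add, sub_add_cancel]

/-- Integration by parts against a test function, for a function of class `C¹`. -/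
lemma integral_smul_gradient {g : Space N → ℝ} {g' : Space N → Space N}
    (hg : ∀ x, HasGradientAt g (g' x) x) (hg' : Continuous g') {η : Space N → ℝ}
    (hη : ContDiff ℝ ∞ η) (hηs : HasCompactSupport η) :
    ∫ x, g x • gradient η x = - ∫ x, η x • g' x := by
  have hgc : Continuous g := continuous_iff_continuousAt.2 fun x => (hg x).continuousAt
  have hi1 : Integrable fun x => g x • gradient η x :=
    (hgc.smul (continuous_gradient hη)).integrable_of_hasCompactSupport
      (hasCompactSupport_gradient hηs).smul_left
  have hi2 : Integrable fun x => η x • g' x :=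
    (hη.continuous.smul hg').integrable_of_hasCompactSupport hηs.smul_right
  refine ext_inner_left ℝ fun h => ?_
  rw [inner_neg_right, ← integral_inner hi1, ← integral_inner hi2]
  have hfd : ∀ x, fderiv ℝ g x h = inner ℝ h (g' x) := fun x => by
    rw [(hasGradientAt_iff_hasFDerivAt.1 (hg x)).fderiv, InnerProductSpace.toDual_apply_apply,
      real_inner_comm]
  have key := integral_mul_fderiv_eq_neg_fderiv_mul_of_integrable (μ := volume) (f := g) (g := η)
    (v := h) ?_ ?_ ?_ (fun x _ => (hg x).differentiableAt)
    (fun x _ => hη.differentiable (by simp) x)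
  · have e1 : ∀ x, inner ℝ h (g x • gradient η x) = g x * fderiv ℝ η x h := fun x => by
      rw [inner_smul_right, real_inner_comm, inner_gradient]
    have e2 : ∀ x, inner ℝ h (η x • g' x) = fderiv ℝ g x h * η x := fun x => by
      rw [inner_smul_right, hfd, mul_comm]
    simp_rw [e1, e2]
    exact key
  · simp_rw [hfd]
    exact ((continuous_const.inner hg').mul hη.continuous).integrable_of_hasCompactSupport
      hηs.mul_left
  · refine (hgc.mul ?_).integrable_of_hasCompactSupport ?_
    · exact (hη.continuous_fderiv (by simp)).clm_apply continuous_const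
    · exact HasCompactSupport.mul_left (hηs.fderiv_apply ℝ h)
  · exact (hgc.mul hη.continuous).integrable_of_hasCompactSupport hηs.mul_left

/-- The chain rule for weak gradients, by mollification. -/
lemma integral_comp_smul_gradient {f f' : ℝ → ℝ} (hf : ∀ t, HasDerivAt f (f' t) t)
    (hf' : Continuous f') (hb : ∀ t, |f' t| ≤ 1) {v : Space N → ℝ} {V : Space N → Space N}
    (hv : Integrable v) (hV : Integrable V) (hw : HasWeakGradient univ v V) {η : Space N → ℝ}
    (hη : ContDiff ℝ ∞ η) (hηs : HasCompactSupport η) :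
    ∫ x, f (v x) • gradient η x = - ∫ x, (η x * f' (v x)) • V x := by
  have hfc : Continuous f := continuous_iff_continuousAt.2 fun t => (hf t).continuousAt
  have hlip : LipschitzWith 1 f := by
    refine lipschitzWith_of_nnnorm_deriv_le (fun t => (hf t).differentiableAt) fun t => ?_
    rw [(hf t).deriv]
    exact_mod_cast hb t
  obtain ⟨C₁, hC₁⟩ := (hasCompactSupport_gradient hηs).exists_bound_of_continuous
    (continuous_gradient hη)
  obtain ⟨C₂, hC₂⟩ := hηs.exists_bound_of_continuous hη.continuous
  set vn := fun n => mollify (bumpSeq N n) v with hvn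
  set Vn := fun n => mollify (bumpSeq N n) V with hVn
  have hvc : ∀ n, Continuous (vn n) := fun n => (contDiff_mollify _ hv.locallyIntegrable).continuous
  have hVc : ∀ n, Continuous (Vn n) := fun n => (contDiff_mollify _ hV.locallyIntegrable).continuous
  have hid : ∀ n, ∫ x, f (vn n x) • gradient η x = - ∫ x, (η x * f' (vn n x)) • Vn n x := by
    intro n
    have h := integral_smul_gradient (g := fun x => f (vn n x))
      (g' := fun x => f' (vn n x) • Vn n x)
      (fun x => ?_) ((hf'.comp (hvc n)).smul (hVc n)) hη hηs
    · simpa only [smul_smul] using h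
    · rw [hasGradientAt_iff_hasFDerivAt, map_smul]
      exact (hf (vn n x)).comp_hasFDerivAt x
        (hasGradientAt_iff_hasFDerivAt.1 (hasGradientAt_mollify (bumpSeq N n) hw x))
  have hae := ae_tendsto_mollify hv.locallyIntegrable
  have hlim1 : Tendsto (fun n => ∫ x, f (vn n x) • gradient η x) atTop
      (𝓝 (∫ x, f (v x) • gradient η x)) := by
    have hfi : ∀ {w : Space N → ℝ}, Integrable w → Integrable fun x => f (w x) • gradient η x := by
      intro w hw
      refine LocallyIntegrable.integrable_smul_right_of_hasCompactSupport ?_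
        (continuous_gradient hη) (hasCompactSupport_gradient hηs)
      have : LocallyIntegrable (fun x : Space N => ‖w x‖ + |f 0|) :=
        hw.norm.locallyIntegrable.add (locallyIntegrable_const _)
      refine this.mono (hfc.comp_aestronglyMeasurable hw.1) (Eventually.of_forall fun x => ?_)
      have h1 := hlip.dist_le_mul (w x) 0
      rw [Real.dist_eq, Real.dist_eq, sub_zero, NNReal.coe_one, one_mul] at h1
      rw [Real.norm_eq_abs, Real.norm_eq_abs, Real.norm_eq_abs,
        abs_of_nonneg (a := |w x| + |f 0|) (by positivity)]
      have h2 := abs_add_le (f (w x) - f 0) (f 0)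
      rw [sub_add_cancel] at h2
      linarith
    refine tendsto_integral_of_L1 _ (hfi hv).1
      (Eventually.of_forall fun n => hfi (integrable_mollify _ hv)) ?_
    have h3 : Tendsto (fun n => ENNReal.ofReal C₁ * ∫⁻ x, ‖vn n x - v x‖ₑ) atTop (𝓝 0) := by
      simpa using ENNReal.Tendsto.const_mul (tendsto_lintegral_mollify_sub hv)
        (Or.inr ENNReal.ofReal_ne_top)
    refine tendsto_of_tendsto_of_tendsto_of_le_of_le tendsto_const_nhds h3
      (fun _ => zero_le) fun n => ?_
    simp only
    rw [← lintegral_const_mul' _ _ ENNReal.ofReal_ne_top]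
    refine lintegral_mono fun x => ?_
    rw [← sub_smul, enorm_smul, mul_comm]
    gcongr
    · rw [← ofReal_norm]
      exact ENNReal.ofReal_le_ofReal (hC₁ x)
    · have h1 := hlip.edist_le_mul (vn n x) (v x)
      rwa [edist_eq_enorm_sub, edist_eq_enorm_sub, ENNReal.coe_one, one_mul] at h1
  have hlim2 : Tendsto (fun n => ∫ x, (η x * f' (vn n x)) • Vn n x) atTop
      (𝓝 (∫ x, (η x * f' (v x)) • V x)) := by
    refine tendsto_integral_smul (C := C₂)
      (fun n => (hη.continuous.mul (hf'.comp (hvc n))).aestronglyMeasurable) (fun n x => ?_) ?_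
      (fun n => integrable_mollify _ hV) hV (tendsto_lintegral_mollify_sub hV)
    · rw [abs_mul]
      calc |η x| * |f' (vn n x)| ≤ |η x| * 1 := by gcongr; exact hb _
        _ ≤ C₂ := by rw [mul_one]; exact hC₂ x
    · filter_upwards [hae] with x hx
      exact ((hf'.tendsto _).comp hx).const_mul _
  refine tendsto_nhds_unique hlim1 ?_
  simp_rw [hid]
  exact hlim2.neg

/-- `√(ε² + (t⁺)²)` is of class `C¹`; minus `ε` it approximates `t⁺`, and its derivative
approximates the indicator function of `{t > 0}`, also at `t = 0`. -/
lemma hasDerivAt_sqrt_sq_add_sq_max {ε : ℝ} (hε : 0 < ε) (t : ℝ) :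
    HasDerivAt (fun t => √(ε ^ 2 + max t 0 ^ 2)) (max t 0 / √(ε ^ 2 + max t 0 ^ 2)) t := by
  have h1 : HasDerivAt (fun t : ℝ => max t 0 ^ 2) (2 * max t 0) t := by
    have hk : (fun t : ℝ => max t 0 ^ 2) = fun t => (t * |t| + t ^ 2) / 2 := by
      ext t
      rcases le_total 0 t with h | h
      · rw [max_eq_left h, abs_of_nonneg h]; ring
      · rw [max_eq_right h, abs_of_nonpos h]; ring
    have habs : HasDerivAt (fun t : ℝ => t * |t|) (2 * |t|) t := by
      rcases eq_or_ne t 0 with rfl | ht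
      · rw [hasDerivAt_iff_isLittleO]
        simp only [sub_zero, abs_zero, mul_zero, smul_zero]
        have : (fun x : ℝ => |x|) =o[𝓝 0] (fun _ => (1 : ℝ)) := by
          rw [Asymptotics.isLittleO_one_iff]
          simpa using (continuous_abs.tendsto (0 : ℝ))
        simpa using (Asymptotics.isBigO_refl (fun x : ℝ => x) (𝓝 0)).mul_isLittleO this
      · have h := (hasDerivAt_id t).mul (hasDerivAt_abs ht)
        refine h.congr_deriv ?_
        have hs : t * (SignType.sign t : ℝ) = |t| := by
          rw [mul_comm, sign_mul_self]
        simp only [id, one_mul, hs]; ring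
    rw [hk]
    refine ((habs.add (hasDerivAt_pow 2 t)).div_const 2).congr_deriv ?_
    rcases le_total 0 t with h | h
    · rw [max_eq_left h, abs_of_nonneg h]; simp
    · rw [max_eq_right h, abs_of_nonpos h]; simp
  have h2 := (h1.const_add (ε ^ 2)).sqrt (by positivity)
  refine h2.congr_deriv ?_
  rw [mul_div_mul_left _ _ two_ne_zero]

lemma max_le_sqrt {ε : ℝ} (t : ℝ) : max t 0 ≤ √(ε ^ 2 + max t 0 ^ 2) :=
  Real.le_sqrt_of_sq_le (by nlinarith [sq_nonneg ε])

/-- The positive part of a function in `W^{1,1}(ℝ^N)` has the weak gradient `1_{v > 0} ∇v`. -/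
lemma HasWeakGradient.max_zero {v : Space N → ℝ} {V : Space N → Space N}
    (hv : Integrable v) (hV : Integrable V) (hw : HasWeakGradient univ v V) :
    HasWeakGradient univ (fun x => max (v x) 0) (fun x => if 0 < v x then V x else 0) ∧
      Integrable (fun x => max (v x) 0) ∧ Integrable (fun x => if 0 < v x then V x else 0) := by
  have hvi : Integrable (fun x => max (v x) 0) := hv.pos_part
  have hset : NullMeasurableSet {x | 0 < v x} volume :=
    nullMeasurableSet_lt aemeasurable_const hv.1.aemeasurable
  have hVi : Integrable (fun x => if 0 < v x then V x else 0) := by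
    have h : (fun x => if 0 < v x then V x else 0) = {x | 0 < v x}.indicator V := by
      ext x; simp [indicator]
    rw [h]; exact hV.indicator₀ hset
  refine ⟨⟨?_, ?_, fun η hη hηs _ => ?_⟩, hvi, hVi⟩
  · rw [locallyIntegrableOn_univ]; exact hvi.locallyIntegrable
  · rw [locallyIntegrableOn_univ]; exact hVi.locallyIntegrable
  rw [setIntegral_univ, setIntegral_univ]
  obtain ⟨C₁, hC₁⟩ := (hasCompactSupport_gradient hηs).exists_bound_of_continuous
    (continuous_gradient hη)
  obtain ⟨C₂, hC₂⟩ := hηs.exists_bound_of_continuous hη.continuous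
  set e : ℕ → ℝ := fun n => 1 / ((n : ℝ) + 1) with he
  have he0 : ∀ n, 0 < e n := fun n => by positivity
  have hel : Tendsto e atTop (𝓝 0) := tendsto_one_div_add_atTop_nhds_zero_nat
  have hsq : ∀ n t, 0 < √(e n ^ 2 + max t 0 ^ 2) := fun n t =>
    Real.sqrt_pos.2 (by have := he0 n; positivity)
  have hcsq : ∀ n, Continuous fun t : ℝ => √(e n ^ 2 + max t 0 ^ 2) := fun n => by fun_prop
  have hsl : ∀ t : ℝ, Tendsto (fun n => √(e n ^ 2 + max t 0 ^ 2)) atTop (𝓝 (max t 0)) := by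
    intro t
    have h := ((hel.pow 2).add_const (max t 0 ^ 2)).sqrt
    simpa [Real.sqrt_sq (le_max_right t 0)] using h
  have hid : ∀ n, ∫ x, (√(e n ^ 2 + max (v x) 0 ^ 2) - e n) • gradient η x
      = - ∫ x, (η x * (max (v x) 0 / √(e n ^ 2 + max (v x) 0 ^ 2))) • V x := by
    intro n
    refine integral_comp_smul_gradient (f := fun t => √(e n ^ 2 + max t 0 ^ 2) - e n)
      (f' := fun t => max t 0 / √(e n ^ 2 + max t 0 ^ 2))
      (fun t => (hasDerivAt_sqrt_sq_add_sq_max (he0 n) t).sub_const _) ?_ ?_ hv hV hw hη hηs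
    · exact (by fun_prop : Continuous fun t : ℝ => max t 0).div (hcsq n) fun t => (hsq n t).ne'
    · intro t
      rw [abs_div, abs_of_pos (hsq n t), abs_of_nonneg (le_max_right _ _)]
      exact div_le_one_of_le₀ (max_le_sqrt t) (hsq n t).le
  have hlim1 : Tendsto (fun n => ∫ x, (√(e n ^ 2 + max (v x) 0 ^ 2) - e n) • gradient η x) atTop
      (𝓝 (∫ x, max (v x) 0 • gradient η x)) := by
    refine tendsto_integral_of_dominated_convergence (fun x => C₁ * ‖v x‖) (fun n => ?_)
      (hv.norm.const_mul C₁) (fun n => Eventually.of_forall fun x => ?_)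
      (Eventually.of_forall fun x => ?_)
    · exact (((hcsq n).sub continuous_const).comp_aestronglyMeasurable hv.1).smul
        (continuous_gradient hη).aestronglyMeasurable
    · rw [norm_smul, mul_comm]
      have hC : 0 ≤ C₁ := (norm_nonneg _).trans (hC₁ x)
      refine mul_le_mul (hC₁ x) ?_ (norm_nonneg _) hC
      have h1 : √(e n ^ 2 + max (v x) 0 ^ 2) ≤ e n + max (v x) 0 := by
        have h0 : 0 ≤ max (v x) 0 := le_max_right _ _
        refine Real.sqrt_le_iff.2 ⟨by linarith [he0 n], ?_⟩
        nlinarith [he0 n, mul_nonneg (he0 n).le h0]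
      have h2 : e n ≤ √(e n ^ 2 + max (v x) 0 ^ 2) :=
        Real.le_sqrt_of_sq_le (by nlinarith [sq_nonneg (max (v x) 0)])
      rw [Real.norm_eq_abs, Real.norm_eq_abs, abs_of_nonneg (by linarith)]
      have h3 : max (v x) 0 ≤ |v x| := max_le (le_abs_self _) (abs_nonneg _)
      linarith
    · simpa using ((hsl (v x)).sub hel).smul_const (gradient η x)
  have hlim2 : Tendsto
      (fun n => ∫ x, (η x * (max (v x) 0 / √(e n ^ 2 + max (v x) 0 ^ 2))) • V x) atTop
      (𝓝 (∫ x, η x • (if 0 < v x then V x else 0))) := by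
    have h : ∀ x, η x • (if 0 < v x then V x else 0) = (η x * if 0 < v x then 1 else 0) • V x := by
      intro x; split_ifs <;> simp
    simp_rw [h]
    refine tendsto_integral_smul (C := C₂) (fun n => ?_) (fun n x => ?_)
      (Eventually.of_forall fun x => ?_) (fun _ => hV) hV (by simp)
    · refine hη.continuous.aestronglyMeasurable.mul (Continuous.comp_aestronglyMeasurable
        (g := fun t : ℝ => max t 0 / √(e n ^ 2 + max t 0 ^ 2)) ?_ hv.1)
      exact (by fun_prop : Continuous fun t : ℝ => max t 0).div (hcsq n) fun t => (hsq n t).ne'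
    · rw [abs_mul, abs_div, abs_of_pos (hsq n _), abs_of_nonneg (le_max_right (v x) 0)]
      calc |η x| * (max (v x) 0 / √(e n ^ 2 + max (v x) 0 ^ 2)) ≤ |η x| * 1 := by
            gcongr
            exact div_le_one_of_le₀ (max_le_sqrt _) (hsq n _).le
        _ ≤ C₂ := by rw [mul_one]; exact hC₂ x
    · refine Tendsto.const_mul _ ?_
      split_ifs with hx
      · have hm : max (v x) 0 ≠ 0 := by rw [max_eq_left hx.le]; exact hx.ne'
        have := (tendsto_const_nhds (x := max (v x) 0)).div (hsl (v x)) hm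
        rwa [div_self hm] at this
      · simp [max_eq_right (not_lt.1 hx)]
  refine tendsto_nhds_unique hlim1 ?_
  simp_rw [hid]
  exact hlim2.neg

end WeakGradient

section TestFunctions

variable {N : ℕ}

lemma gradient_mul {f g : Space N → ℝ} {x : Space N} (hf : DifferentiableAt ℝ f x)
    (hg : DifferentiableAt ℝ g x) :
    gradient (fun x => f x * g x) x = f x • gradient g x + g x • gradient f x := by
  have h : HasFDerivAt (fun x => f x * g x) (f x • fderiv ℝ g x + g x • fderiv ℝ f x) x :=
    hf.hasFDerivAt.mul hg.hasFDerivAt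
  simp [gradient, h.fderiv]

lemma gradient_eq_zero_of_notMem_tsupport {f : Space N → ℝ} {x : Space N} (hx : x ∉ tsupport f) :
    gradient f x = 0 := by
  have h : f =ᶠ[𝓝 x] fun _ => 0 := notMem_tsupport_iff_eventuallyEq.1 hx
  rw [h.gradient_eq, gradient_fun_const]

lemma integrable_smul_of_tsupport_subset {X : Type*} [NormedAddCommGroup X] [NormedSpace ℝ X]
    {Ω : Set (Space N)} {f : Space N → X} (hf : LocallyIntegrableOn f Ω) {χ : Space N → ℝ}
    (hχ : Continuous χ) (hχs : HasCompactSupport χ) (hΩ : tsupport χ ⊆ Ω) :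
    Integrable fun x => χ x • f x := by
  have h1 : IntegrableOn (fun x => χ x • f x) (tsupport χ) :=
    (hf.integrableOn_compact_subset hΩ hχs.isCompact).continuousOn_smul hχ.continuousOn
      hχs.isCompact
  refine (integrableOn_iff_integrable_of_support_subset fun x hx => ?_).1 h1
  exact subset_tsupport _ (left_ne_zero_of_smul hx)

lemma integrable_smul_gradient_of_tsupport_subset
    {Ω : Set (Space N)} {f : Space N → ℝ} (hf : LocallyIntegrableOn f Ω) {χ : Space N → ℝ}
    (hχ : ContDiff ℝ ∞ χ) (hχs : HasCompactSupport χ) (hΩ : tsupport χ ⊆ Ω) :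
    Integrable fun x => f x • gradient χ x := by
  have h1 : IntegrableOn (fun x => f x • gradient χ x) (tsupport χ) :=
    (hf.integrableOn_compact_subset hΩ hχs.isCompact).smul_continuousOn
      (continuous_gradient hχ).continuousOn hχs.isCompact
  refine (integrableOn_iff_integrable_of_support_subset fun x hx => ?_).1 h1
  by_contra hx'
  exact right_ne_zero_of_smul hx (gradient_eq_zero_of_notMem_tsupport hx')

lemma HasWeakGradient.integral_smul_gradient_eq {Ω : Set (Space N)} {u : Space N → ℝ}
    {G : Space N → Space N} (h : HasWeakGradient Ω u G) {η : Space N → ℝ} (hη : ContDiff ℝ ∞ η)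
    (hηs : HasCompactSupport η) (hηΩ : tsupport η ⊆ Ω) :
    ∫ x, u x • gradient η x = - ∫ x, η x • G x := by
  have h1 := h.2.2 η hη hηs hηΩ
  rwa [setIntegral_eq_integral_of_forall_compl_eq_zero,
    setIntegral_eq_integral_of_forall_compl_eq_zero] at h1
  · intro x hx
    rw [image_eq_zero_of_notMem_tsupport fun h => hx (hηΩ h), zero_smul]
  · intro x hx
    rw [gradient_eq_zero_of_notMem_tsupport fun h => hx (hηΩ h), smul_zero]

/-- Product rule: a smooth cutoff function turns a weak gradient in `Ω` into one in `ℝ^N`. -/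
lemma HasWeakGradient.mul_cutoff {Ω : Set (Space N)} {u : Space N → ℝ}
    {G : Space N → Space N} (h : HasWeakGradient Ω u G) {χ : Space N → ℝ} (hχ : ContDiff ℝ ∞ χ)
    (hχs : HasCompactSupport χ) (hχΩ : tsupport χ ⊆ Ω) :
    HasWeakGradient univ (fun x => χ x * u x) (fun x => χ x • G x + u x • gradient χ x) ∧
      Integrable (fun x => χ x * u x) ∧ Integrable (fun x => χ x • G x + u x • gradient χ x) := by
  have hi1 : Integrable (fun x => χ x * u x) :=
    integrable_smul_of_tsupport_subset h.1 hχ.continuous hχs hχΩ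
  have hi2 : Integrable (fun x => χ x • G x + u x • gradient χ x) :=
    (integrable_smul_of_tsupport_subset h.2.1 hχ.continuous hχs hχΩ).add
      (integrable_smul_gradient_of_tsupport_subset h.1 hχ hχs hχΩ)
  refine ⟨⟨?_, ?_, fun η hη hηs _ => ?_⟩, hi1, hi2⟩
  · rw [locallyIntegrableOn_univ]; exact hi1.locallyIntegrable
  · rw [locallyIntegrableOn_univ]; exact hi2.locallyIntegrable
  rw [setIntegral_univ, setIntegral_univ]
  have hc : ContDiff ℝ ∞ fun x => η x * χ x := hη.mul hχ
  have hcs : HasCompactSupport fun x => η x * χ x := hηs.mul_right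
  have hcΩ : tsupport (fun x => η x * χ x) ⊆ Ω := (tsupport_mul_subset_right).trans hχΩ
  have hid := h.integral_smul_gradient_eq hc hcs hcΩ
  have hj1 : Integrable fun x => u x • gradient (fun x => η x * χ x) x :=
    integrable_smul_gradient_of_tsupport_subset h.1 hc hcs hcΩ
  have hj2 : Integrable fun x => (η x * χ x) • G x :=
    integrable_smul_of_tsupport_subset h.2.1 hc.continuous hcs hcΩ
  obtain ⟨C, hC⟩ := hηs.exists_bound_of_continuous hη.continuous
  have hj3 : Integrable fun x => η x • (u x • gradient χ x) :=
    (integrable_smul_gradient_of_tsupport_subset h.1 hχ hχs hχΩ).bdd_smul C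
      hη.continuous.aestronglyMeasurable (Eventually.of_forall hC)
  have e1 : ∀ x, (χ x * u x) • gradient η x
      = u x • gradient (fun x => η x * χ x) x - η x • (u x • gradient χ x) := by
    intro x
    rw [gradient_mul (hη.differentiable (by simp) x) (hχ.differentiable (by simp) x)]
    module
  have e2 : ∀ x, η x • (χ x • G x + u x • gradient χ x)
      = (η x * χ x) • G x + η x • (u x • gradient χ x) := by
    intro x; module
  simp_rw [e1, e2]
  rw [integral_sub hj1 hj3, integral_add hj2 hj3, hid]
  abel

lemma HasWeakGradient.const_sub {Ω : Set (Space N)} {u : Space N → ℝ}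
    {G : Space N → Space N} (h : HasWeakGradient Ω u G) (k : ℝ) :
    HasWeakGradient Ω (fun x => k - u x) (fun x => - G x) := by
  have hk : LocallyIntegrableOn (fun _ : Space N => k) Ω :=
    (locallyIntegrable_const k).locallyIntegrableOn Ω
  refine ⟨hk.sub h.1, h.2.1.neg, fun η hη hηs hηΩ => ?_⟩
  rw [setIntegral_eq_integral_of_forall_compl_eq_zero,
    setIntegral_eq_integral_of_forall_compl_eq_zero]
  · have h0 : ∫ x, k • gradient η x = 0 := by
      have := integral_smul_gradient (g := fun _ : Space N => k) (g' := fun _ => 0)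
        (fun x => hasGradientAt_const x k) continuous_const hη hηs
      simpa using this
    have hi1 := integrable_smul_gradient_of_tsupport_subset hk hη hηs hηΩ
    have hi2 := integrable_smul_gradient_of_tsupport_subset h.1 hη hηs hηΩ
    simp_rw [sub_smul, smul_neg]
    rw [integral_sub hi1 hi2, h0, h.integral_smul_gradient_eq hη hηs hηΩ, integral_neg]
    simp
  · intro x hx
    rw [image_eq_zero_of_notMem_tsupport fun h => hx (hηΩ h), zero_smul]
  · intro x hx
    rw [gradient_eq_zero_of_notMem_tsupport fun h => hx (hηΩ h), smul_zero]

lemma exists_bump_eq_one {Ω : Set (Space N)} (hΩ : IsOpen Ω) {y : Space N} {r : ℝ} (hr : 0 < r)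
    (hball : Metric.closedBall y r ⊆ Ω) :
    ∃ χ : Space N → ℝ, ContDiff ℝ ∞ χ ∧ HasCompactSupport χ ∧ tsupport χ ⊆ Ω ∧
      ∀ x ∈ Metric.closedBall y r, χ =ᶠ[𝓝 x] fun _ => 1 := by
  obtain ⟨δ, hδ, hsub⟩ := (isCompact_closedBall y r).exists_cthickening_subset_open hΩ hball
  rw [cthickening_closedBall hδ.le hr.le] at hsub
  let χ : ContDiffBump y := ⟨r + δ / 2, r + δ, by positivity, by linarith⟩
  refine ⟨χ, χ.contDiff, χ.hasCompactSupport, ?_, fun x hx => ?_⟩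
  · rw [χ.tsupport_eq]; rwa [add_comm] at hsub
  · refine χ.eventuallyEq_one_of_mem_ball ?_
    rw [Metric.mem_ball]
    exact (Metric.mem_closedBall.1 hx).trans_lt (by change r < r + δ / 2; linarith)

/-- The weak gradient of the truncated and localized test function `(k - u)⁺ ψ`. -/
lemma HasWeakGradient.truncation_mul {Ω : Set (Space N)} (hΩ : IsOpen Ω) {u : Space N → ℝ}
    {G : Space N → Space N} (h : HasWeakGradient Ω u G) {y : Space N} {r : ℝ} (hr : 0 < r)
    (hball : Metric.closedBall y r ⊆ Ω) (k : ℝ) {ψ : Space N → ℝ} (hψ : ContDiff ℝ ∞ ψ)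
    (hψs : tsupport ψ ⊆ Metric.closedBall y r) :
    HasWeakGradient univ (fun x => max (k - u x) 0 * ψ x)
        (fun x => max (k - u x) 0 • gradient ψ x - if u x < k then ψ x • G x else 0) ∧
      Integrable (fun x => max (k - u x) 0 * ψ x) ∧
      Integrable
        (fun x => max (k - u x) 0 • gradient ψ x - if u x < k then ψ x • G x else 0) := by
  obtain ⟨χ, hχ, hχs, hχΩ, hχ1⟩ := exists_bump_eq_one hΩ hr hball
  obtain ⟨h1, hi1, hi2⟩ := (h.const_sub k).mul_cutoff hχ hχs hχΩ
  obtain ⟨h2, -, -⟩ := HasWeakGradient.max_zero hi1 hi2 h1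
  have hψc : HasCompactSupport ψ :=
    HasCompactSupport.of_support_subset_isCompact (isCompact_closedBall y r)
      ((subset_tsupport ψ).trans hψs)
  have h3 := h2.mul_cutoff hψ hψc (subset_univ _)
  have e1 : (fun x => max (k - u x) 0 * ψ x) = fun x => ψ x * max (χ x * (k - u x)) 0 := by
    ext x
    by_cases hx : x ∈ Metric.closedBall y r
    · rw [(hχ1 x hx).self_of_nhds, one_mul, mul_comm]
    · rw [image_eq_zero_of_notMem_tsupport fun h => hx (hψs h), zero_mul, mul_zero]
  have e2 : (fun x => max (k - u x) 0 • gradient ψ x - if u x < k then ψ x • G x else 0)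
      = fun x => ψ x • (if 0 < χ x * (k - u x) then χ x • (- G x) + (k - u x) • gradient χ x
          else 0) + max (χ x * (k - u x)) 0 • gradient ψ x := by
    ext1 x
    by_cases hx : x ∈ Metric.closedBall y r
    · rw [(hχ1 x hx).self_of_nhds, (hχ1 x hx).gradient_eq, gradient_fun_const]
      simp only [one_mul, sub_pos, one_smul, smul_zero, add_zero]
      split_ifs
      · module
      · module
    · rw [image_eq_zero_of_notMem_tsupport fun h => hx (hψs h),
        gradient_eq_zero_of_notMem_tsupport fun h => hx (hψs h)]
      simp
  rw [e1, e2]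
  exact h3

/-! ### The Sobolev inequality in `W^{1,1}` and cutoff functions -/

/-- The Sobolev exponent `N / (N - 1)` for `W^{1,1}(ℝ^N)`. -/
noncomputable def sobolevExponent (N : ℕ) : NNReal := NNReal.conjExponent N

lemma holderConjugate_sobolevExponent (hN : 2 ≤ N) :
    NNReal.HolderConjugate (N : NNReal) (sobolevExponent N) :=
  NNReal.HolderConjugate.conjExponent (by exact_mod_cast hN)

/-- The Gagliardo-Nirenberg-Sobolev inequality, extended from smooth functions to `W^{1,1}` by
mollification and Fatou's lemma. -/
lemma HasWeakGradient.eLpNorm_le (hN : 2 ≤ N) {f : Space N → ℝ} {F : Space N → Space N}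
    (h : HasWeakGradient univ f F) (hf : Integrable f) (hF : Integrable F)
    (hfs : HasCompactSupport f) :
    eLpNorm f (sobolevExponent N) volume
      ≤ eLpNormLESNormFDerivOneConst (volume : Measure (Space N)) (sobolevExponent N)
        * ∫⁻ x, ‖F x‖ₑ := by
  have hfc : ∀ n, ContDiff ℝ ∞ (mollify (bumpSeq N n) f) := fun n =>
    contDiff_mollify _ hf.locallyIntegrable
  refine Lp.eLpNorm_le_of_ae_tendsto (u := atTop) (f := fun n => mollify (bumpSeq N n) f)
    (Eventually.of_forall fun n => ?_) (fun n => (hfc n).continuous.aestronglyMeasurable)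
    (ae_tendsto_mollify hf.locallyIntegrable)
  have hq : NNReal.HolderConjugate (Module.finrank ℝ (Space N)) (sobolevExponent N) := by
    rw [finrank_euclideanSpace_fin]; exact holderConjugate_sobolevExponent hN
  refine (eLpNorm_le_eLpNorm_fderiv_one volume ((hfc n).of_le (by simp))
    ((bumpSeq N n).hasCompactSupport_normed.convolution _ hfs) hq).trans ?_
  gcongr
  rw [eLpNorm_one_eq_lintegral_enorm]
  refine le_trans (le_of_eq ?_) (lintegral_enorm_mollify_le (bumpSeq N n) hF.1)
  refine lintegral_congr fun x => ?_
  rw [(hasGradientAt_iff_hasFDerivAt.1 (hasGradientAt_mollify (bumpSeq N n) h x)).fderiv]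
  rw [← ofReal_norm, ← ofReal_norm, LinearIsometryEquiv.norm_map]

lemma exists_abs_deriv_smoothTransition_le :
    ∃ K : ℝ, 0 ≤ K ∧ ∀ t, |deriv Real.smoothTransition t| ≤ K := by
  have hc : Continuous (deriv Real.smoothTransition) :=
    (Real.smoothTransition.contDiff (n := 1)).continuous_deriv le_rfl
  obtain ⟨K, hK⟩ := (isCompact_Icc (a := (0 : ℝ)) (b := 1)).exists_bound_of_continuousOn
    hc.continuousOn
  have hK0 : 0 ≤ K := (norm_nonneg _).trans (hK 0 (by simp))
  refine ⟨K, hK0, fun t => ?_⟩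
  rcases lt_or_ge t 0 with h0 | h0
  · have : Real.smoothTransition =ᶠ[𝓝 t] fun _ => 0 := by
      filter_upwards [gt_mem_nhds h0] with s hs using Real.smoothTransition.zero_of_nonpos hs.le
    rw [this.deriv_eq]; simpa using hK0
  rcases le_or_gt t 1 with h1 | h1
  · exact hK t ⟨h0, h1⟩
  · have : Real.smoothTransition =ᶠ[𝓝 t] fun _ => 1 := by
      filter_upwards [lt_mem_nhds h1] with s hs using Real.smoothTransition.one_of_one_le hs.le
    rw [this.deriv_eq]; simpa using hK0

/-- Smooth cutoff functions between concentric balls, with the natural bound of the gradient. -/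
lemma exists_cutoff : ∃ K : ℝ, 1 ≤ K ∧ ∀ (N : ℕ) (y : Space N) (ρ R : ℝ), 0 < ρ → ρ < R →
    ∃ η : Space N → ℝ, ContDiff ℝ ∞ η ∧ (∀ x, 0 ≤ η x) ∧ (∀ x, η x ≤ 1) ∧
      (∀ x ∈ Metric.ball y ρ, η x = 1) ∧ (∀ x ∉ Metric.ball y R, η x = 0) ∧
      ∀ x, ‖gradient η x‖ ≤ K / (R - ρ) := by
  obtain ⟨K, hK0, hK⟩ := exists_abs_deriv_smoothTransition_le
  refine ⟨max (2 * K) 1, le_max_right _ _, fun N y ρ R hρ hR => ?_⟩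
  have hRρ : 0 < R - ρ := sub_pos.2 hR
  have hd : 0 < R ^ 2 - ρ ^ 2 := by nlinarith
  set a : Space N → ℝ := fun x => (R ^ 2 - ‖x - y‖ ^ 2) / (R ^ 2 - ρ ^ 2) with ha
  have hac : ContDiff ℝ ∞ a := by
    refine ContDiff.div_const (contDiff_const.sub ?_) _
    exact (contDiff_id.sub contDiff_const).norm_sq ℝ
  refine ⟨fun x => Real.smoothTransition (a x), Real.smoothTransition.contDiff.comp hac,
    fun x => Real.smoothTransition.nonneg _, fun x => Real.smoothTransition.le_one _,
    fun x hx => ?_, fun x hx => ?_, fun x => ?_⟩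
  · refine Real.smoothTransition.one_of_one_le ((one_le_div hd).2 ?_)
    rw [Metric.mem_ball, dist_eq_norm] at hx
    have := pow_le_pow_left₀ (norm_nonneg _) hx.le 2
    linarith
  · refine Real.smoothTransition.zero_of_nonpos (div_nonpos_of_nonpos_of_nonneg ?_ hd.le)
    rw [Metric.mem_ball, dist_eq_norm, not_lt] at hx
    have := pow_le_pow_left₀ (hρ.trans hR).le hx 2
    linarith
  · have hda : HasFDerivAt a ((R ^ 2 - ρ ^ 2)⁻¹ • -((2 : ℝ) • (innerSL ℝ (x - y)))) x := by
      have h1 : HasFDerivAt (fun x : Space N => ‖x - y‖ ^ 2)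
          ((2 : ℝ) • (innerSL ℝ (x - y))) x := by
        have := ((hasFDerivAt_id x).sub_const y).norm_sq
        refine this.congr_fderiv ?_
        ext z; simp [two_smul]
      have h2 := (h1.const_sub (R ^ 2)).const_mul (R ^ 2 - ρ ^ 2)⁻¹
      refine h2.congr_of_eventuallyEq (Eventually.of_forall fun z => ?_)
      simp only [ha]; rw [div_eq_inv_mul]
    have hdS : HasDerivAt Real.smoothTransition (deriv Real.smoothTransition (a x)) (a x) :=
      ((Real.smoothTransition.contDiff (n := 1)).differentiable one_ne_zero _).hasDerivAt
    have hη := hdS.comp_hasFDerivAt x hda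
    rw [norm_gradient]
    have hfd : fderiv ℝ (fun x => Real.smoothTransition (a x)) x = _ := hη.fderiv
    rw [hfd, norm_smul, norm_smul, norm_neg, Real.norm_eq_abs, Real.norm_eq_abs,
      abs_of_pos (inv_pos.2 hd), norm_smul, innerSL_apply_norm]
    simp only [Real.norm_ofNat]
    rcases le_or_gt ‖x - y‖ R with hx | hx
    · calc |deriv Real.smoothTransition (a x)| * ((R ^ 2 - ρ ^ 2)⁻¹ * (2 * ‖x - y‖))
          ≤ K * ((R ^ 2 - ρ ^ 2)⁻¹ * (2 * (R + ρ))) := by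
            gcongr
            · exact hK _
            · linarith
        _ = 2 * K / (R - ρ) := by
            have : R + ρ ≠ 0 := by linarith
            have h3 : R ^ 2 - ρ ^ 2 = (R - ρ) * (R + ρ) := by ring
            rw [h3]
            field_simp
        _ ≤ _ := by gcongr; exact le_max_left _ _
    · have hax : a x < 0 := by
        refine div_neg_of_neg_of_pos ?_ hd
        have := pow_lt_pow_left₀ hx (by linarith) two_ne_zero
        linarith
      have h0 : Real.smoothTransition =ᶠ[𝓝 (a x)] fun _ => 0 := by
        filter_upwards [gt_mem_nhds hax] with s hs using
          Real.smoothTransition.zero_of_nonpos hs.le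
      rw [h0.deriv_eq]
      simp only [deriv_const', abs_zero, zero_mul]
      positivity

end TestFunctions

/-! ### The nonlocal term -/

section Nonlocal

variable {N : ℕ}

/-- The mass of the fractional kernel, truncated at the origin by `min 1 |z| ^ p`. -/
noncomputable def kernelMass (N : ℕ) (p s : ℝ) : ℝ≥0∞ :=
  ∫⁻ z : Space N, ENNReal.ofReal (min 1 ‖z‖ ^ p * ‖z‖ ^ (-((N : ℝ) + p * s)))

lemma nontrivial_space (hN : 2 ≤ N) : Nontrivial (Space N) := by
  refine Module.nontrivial_of_finrank_pos (R := ℝ) ?_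
  rw [finrank_euclideanSpace_fin]; omega

lemma kernelMass_ne_top (hN : 2 ≤ N) {p s : ℝ} (hp : 1 < p) (hs₀ : 0 < s) (hs₁ : s < 1) :
    kernelMass N p s ≠ ⊤ := by
  have hp0 : 0 < p := by linarith
  have hNe := nontrivial_space hN
  set f : ℝ → ℝ := fun t => min 1 t ^ p * t ^ (-((N : ℝ) + p * s)) with hf
  have hcast : ((N - 1 : ℕ) : ℝ) = N - 1 := by rw [Nat.cast_sub (by omega), Nat.cast_one]
  have h1 : IntegrableOn (fun t : ℝ => t ^ (N - 1) • f t) (Ioc 0 1) := by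
    have h : IntegrableOn (fun t : ℝ => t ^ (p * (1 - s) - 1)) (Ioc 0 1) := by
      rw [← intervalIntegrable_iff_integrableOn_Ioc_of_le zero_le_one]
      exact intervalIntegral.intervalIntegrable_rpow' (by nlinarith [mul_pos hp0 (sub_pos.2 hs₁)])
    refine h.congr_fun (fun t ht => ?_) measurableSet_Ioc
    simp only [hf, smul_eq_mul]
    rw [min_eq_right ht.2, ← Real.rpow_natCast, hcast, ← Real.rpow_add ht.1, ← Real.rpow_add ht.1]
    congr 1; ring
  have h2 : IntegrableOn (fun t : ℝ => t ^ (N - 1) • f t) (Ioi 1) := by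
    have h : IntegrableOn (fun t : ℝ => t ^ (-1 - p * s)) (Ioi 1) :=
      integrableOn_Ioi_rpow_of_lt (by nlinarith [mul_pos hp0 hs₀]) one_pos
    refine h.congr_fun (fun t ht => ?_) measurableSet_Ioi
    have ht0 : (0 : ℝ) < t := one_pos.trans ht
    simp only [hf, smul_eq_mul]
    rw [min_eq_left (le_of_lt ht), Real.one_rpow, one_mul, ← Real.rpow_natCast, hcast,
      ← Real.rpow_add ht0]
    congr 1; ring
  have h3 : Integrable fun z : Space N => f ‖z‖ := by
    rw [integrable_fun_norm_addHaar, finrank_euclideanSpace_fin, ← Ioc_union_Ioi_eq_Ioi zero_le_one]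
    exact h1.union h2
  have h4 := h3.2.ne
  refine ne_of_eq_of_ne (lintegral_congr fun z => ?_) h4
  rw [← ofReal_norm, Real.norm_of_nonneg]
  positivity

/-- An upper bound of the Bochner integral that needs no integrability: if `f` is not integrable,
the left-hand side is `0` by convention, and the right-hand side is nonnegative. -/
lemma integral_le_toReal_lintegral_ofReal {α : Type*} [MeasurableSpace α] {μ : Measure α}
    (f : α → ℝ) : ∫ x, f x ∂μ ≤ (∫⁻ x, ENNReal.ofReal (f x) ∂μ).toReal := by
  by_cases hf : Integrable f μ
  · rw [integral_eq_lintegral_pos_part_sub_lintegral_neg_part hf]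
    linarith [ENNReal.toReal_nonneg (a := ∫⁻ x, ENNReal.ofReal (-f x) ∂μ)]
  · rw [integral_undef hf]; exact ENNReal.toReal_nonneg

/-- Upper bound of the nonlocal form for the test function `(k - u)⁺ η ^ m`: it is controlled by
the measure of the set `E` that carries the test function. -/
lemma nonlocalForm_le (hN : 2 ≤ N) {p s : ℝ} (hp : 1 < p) (hs₀ : 0 < s) (hs₁ : s < 1) {m : ℕ}
    (hm : p ≤ m) {u η : Space N → ℝ} {k K Λ : ℝ} (hK : 0 ≤ K) (hu : ∀ᵐ x, k - u x ≤ K)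
    (hη₀ : ∀ x, 0 ≤ η x) (hη₁ : ∀ x, η x ≤ 1) (hΛ : 1 ≤ Λ)
    (hη : ∀ x y, |η x - η y| ≤ Λ * ‖x - y‖) {E : Set (Space N)} (hE : volume E ≠ ⊤)
    (hφE : ∀ x ∉ E, max (k - u x) 0 * η x ^ m = 0) :
    nonlocalForm p s u (fun x => max (k - u x) 0 * η x ^ m)
      ≤ 2 * (m * 2 ^ m * K) ^ p * (kernelMass N p s).toReal * Λ ^ p * volume.real E := by
  set T := toMeasurable volume E with hT
  have hTm : MeasurableSet T := measurableSet_toMeasurable _ _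
  have hTE : volume T = volume E := measure_toMeasurable E
  set c : ℝ := (m * 2 ^ m * K) ^ p * Λ ^ p with hc
  have hc0 : 0 ≤ c := by positivity
  set κ : Space N → ℝ := fun z => min 1 ‖z‖ ^ p * ‖z‖ ^ (-((N : ℝ) + p * s)) with hκ
  set k' : Space N → ℝ≥0∞ := fun z => ENNReal.ofReal (κ z) with hk'
  have hκm : Measurable k' := by
    refine ENNReal.measurable_ofReal.comp ?_
    have h1 : Measurable fun z : Space N => min 1 ‖z‖ := measurable_const.min measurable_norm
    exact (h1.pow_const p).mul (measurable_norm.pow_const _)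
  have hkm : Measurable fun z : Space N × Space N => k' (z.1 - z.2) :=
    hκm.comp (measurable_fst.sub measurable_snd)
  set i : Space N → ℝ≥0∞ := T.indicator 1 with hi
  have him : Measurable i := measurable_one.indicator hTm
  set F : Space N × Space N → ℝ := fun z => |u z.1 - u z.2| ^ (p - 2) * (u z.1 - u z.2) *
    (max (k - u z.1) 0 * η z.1 ^ m - max (k - u z.2) 0 * η z.2 ^ m) *
      ‖z.1 - z.2‖ ^ (-((N : ℝ) + p * s)) with hF
  have hae1 : ∀ᵐ z : Space N × Space N, k - u z.1 ≤ K :=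
    Measure.quasiMeasurePreserving_fst.ae hu
  have hae2 : ∀ᵐ z : Space N × Space N, k - u z.2 ≤ K :=
    Measure.quasiMeasurePreserving_snd.ae hu
  have hpt : ∀ᵐ z : Space N × Space N,
      ENNReal.ofReal (F z) ≤ ENNReal.ofReal c * ((i z.1 + i z.2) * k' (z.1 - z.2)) := by
    filter_upwards [hae1, hae2] with z h1 h2
    by_cases hz : z.1 ∈ E ∨ z.2 ∈ E
    · have h3 : F z ≤ c * κ (z.1 - z.2) := by
        have h4 := nonlocal_integrand_le hp hm hK h1 h2 (hη₀ z.1) (hη₁ z.1) (hη₀ z.2) (hη₁ z.2)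
        have h5 : |η z.1 - η z.2| ≤ Λ * min 1 ‖z.1 - z.2‖ := by
          have h6 : |η z.1 - η z.2| ≤ 1 :=
            abs_sub_le_iff.2 ⟨by linarith [hη₀ z.2, hη₁ z.1], by linarith [hη₀ z.1, hη₁ z.2]⟩
          rcases le_total 1 ‖z.1 - z.2‖ with h | h
          · rw [min_eq_left h]; linarith
          · rw [min_eq_right h]; exact hη _ _
        calc F z ≤ (m * 2 ^ m * K * |η z.1 - η z.2|) ^ p * ‖z.1 - z.2‖ ^ (-((N : ℝ) + p * s)) := by
              rw [hF]; simp only; gcongr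
          _ ≤ (m * 2 ^ m * K * (Λ * min 1 ‖z.1 - z.2‖)) ^ p
                * ‖z.1 - z.2‖ ^ (-((N : ℝ) + p * s)) := by gcongr
          _ = c * κ (z.1 - z.2) := by
              have hΛ0 : 0 ≤ Λ := by linarith
              rw [Real.mul_rpow (by positivity) (by positivity), Real.mul_rpow hΛ0 (by positivity)]
              simp only [hc, hκ]; ring
      have h7 : 1 ≤ i z.1 + i z.2 := by
        rcases hz with hz | hz
        · have : i z.1 = 1 := indicator_of_mem (subset_toMeasurable _ _ hz) _
          rw [this]; exact le_self_add
        · have : i z.2 = 1 := indicator_of_mem (subset_toMeasurable _ _ hz) _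
          rw [this]; exact le_add_self
      calc ENNReal.ofReal (F z) ≤ ENNReal.ofReal (c * κ (z.1 - z.2)) := ENNReal.ofReal_le_ofReal h3
        _ = ENNReal.ofReal c * (1 * k' (z.1 - z.2)) := by rw [ENNReal.ofReal_mul hc0, one_mul]
        _ ≤ _ := by gcongr
    · push Not at hz
      have : F z = 0 := by
        simp only [hF]
        rw [hφE _ hz.1, hφE _ hz.2]; simp
      rw [this, ENNReal.ofReal_zero]; exact zero_le
  have hit : ∀ x, i x ≠ ⊤ := fun x => by
    by_cases hx : x ∈ T
    · simp [hi, hx]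
    · simp [hi, hx]
  have hm1 : Measurable fun z : Space N × Space N => i z.1 * k' (z.1 - z.2) :=
    (him.comp measurable_fst).mul hkm
  have hm2 : Measurable fun z : Space N × Space N => i z.2 * k' (z.1 - z.2) :=
    (him.comp measurable_snd).mul hkm
  have hint1 : ∫⁻ z : Space N × Space N, i z.1 * k' (z.1 - z.2) = volume E * kernelMass N p s := by
    rw [Measure.volume_eq_prod, lintegral_prod _ hm1.aemeasurable]
    have : ∀ x : Space N, ∫⁻ y, i x * k' (x - y) = i x * kernelMass N p s := fun x => by
      rw [lintegral_const_mul' _ _ (hit x),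
        lintegral_sub_left_eq_self k' x]; rfl
    simp_rw [this]
    rw [lintegral_mul_const _ him, hi, lintegral_indicator_one hTm, hTE]
  have hint2 : ∫⁻ z : Space N × Space N, i z.2 * k' (z.1 - z.2) = volume E * kernelMass N p s := by
    rw [Measure.volume_eq_prod, lintegral_prod_symm _ hm2.aemeasurable]
    have : ∀ y : Space N, ∫⁻ x, i y * k' (x - y) = i y * kernelMass N p s := fun y => by
      rw [lintegral_const_mul' _ _ (hit y),
        lintegral_sub_right_eq_self k' y]; rfl
    simp_rw [this]
    rw [lintegral_mul_const _ him, hi, lintegral_indicator_one hTm, hTE]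
  have hint : ∫⁻ z, ENNReal.ofReal (F z)
      ≤ ENNReal.ofReal c * (volume E * kernelMass N p s + volume E * kernelMass N p s) := by
    refine (lintegral_mono_ae hpt).trans (le_of_eq ?_)
    rw [lintegral_const_mul' _ _ ENNReal.ofReal_ne_top]
    simp_rw [add_mul]
    rw [lintegral_add_left hm1, hint1, hint2]
  have hfin : volume E * kernelMass N p s ≠ ⊤ :=
    ENNReal.mul_ne_top hE (kernelMass_ne_top hN hp hs₀ hs₁)
  have hfin2 : ENNReal.ofReal c * (volume E * kernelMass N p s + volume E * kernelMass N p s) ≠ ⊤ :=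
    ENNReal.mul_ne_top ENNReal.ofReal_ne_top (ENNReal.add_ne_top.2 ⟨hfin, hfin⟩)
  refine (integral_le_toReal_lintegral_ofReal F).trans
    ((ENNReal.toReal_mono hfin2 hint).trans (le_of_eq ?_))
  rw [ENNReal.toReal_mul, ENNReal.toReal_add hfin hfin, ENNReal.toReal_mul,
    ENNReal.toReal_ofReal hc0, measureReal_def]
  simp only [hc]; ring

end Nonlocal

/-! ### The Caccioppoli estimate -/

section Caccioppoli

variable {N : ℕ}

/-- `η` is a smooth cutoff function with values in `[0, 1]` that vanishes outside the ball
`B_r(y)` and has a gradient bounded by `Λ`. -/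
structure IsCutoff (η : Space N → ℝ) (y : Space N) (r Λ : ℝ) : Prop where
  contDiff : ContDiff ℝ ∞ η
  nonneg : ∀ x, 0 ≤ η x
  le_one : ∀ x, η x ≤ 1
  eq_zero : ∀ x ∉ Metric.ball y r, η x = 0
  norm_gradient_le : ∀ x, ‖gradient η x‖ ≤ Λ

lemma IsCutoff.abs_sub_le {η : Space N → ℝ} {y : Space N} {r Λ : ℝ} (h : IsCutoff η y r Λ)
    (x z : Space N) : |η x - η z| ≤ Λ * ‖x - z‖ := by
  refine convex_univ.norm_image_sub_le_of_norm_fderiv_le (𝕜 := ℝ)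
    (fun w _ => h.contDiff.differentiable (by simp) w) (fun w _ => ?_) (mem_univ z) (mem_univ x)
  rw [← norm_gradient]; exact h.norm_gradient_le w

lemma IsCutoff.tsupport_pow_subset {η : Space N → ℝ} {y : Space N} {r Λ : ℝ}
    (h : IsCutoff η y r Λ) {m : ℕ} (hm : m ≠ 0) :
    tsupport (fun x => η x ^ m) ⊆ Metric.closedBall y r := by
  refine closure_minimal (fun x hx => ?_) Metric.isClosed_closedBall
  by_contra hx'
  refine hx ?_
  simp only
  rw [h.eq_zero x fun h => hx' (Metric.ball_subset_closedBall h), zero_pow hm]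

/-- The test function `(k - u)⁺ η ^ m`. -/
noncomputable def testFun (u η : Space N → ℝ) (k : ℝ) (m : ℕ) (x : Space N) : ℝ :=
  max (k - u x) 0 * η x ^ m

/-- The weak gradient of the test function `(k - u)⁺ η ^ m`, where `G = ∇u`. -/
noncomputable def testGrad (u : Space N → ℝ) (G : Space N → Space N) (η : Space N → ℝ) (k : ℝ)
    (m : ℕ) (x : Space N) : Space N :=
  (max (k - u x) 0 * (m * η x ^ (m - 1))) • gradient η x - if u x < k then η x ^ m • G x else 0

lemma gradient_pow {η : Space N → ℝ} {x : Space N} (h : DifferentiableAt ℝ η x) (m : ℕ) :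
    gradient (fun x => η x ^ m) x = (m * η x ^ (m - 1)) • gradient η x := by
  have := (h.hasFDerivAt.pow m).fderiv
  simp [gradient, this]

lemma testFun_eq_zero {u η : Space N → ℝ} {k : ℝ} {m : ℕ} (hm : m ≠ 0) {x : Space N}
    (h : ¬ (u x < k ∧ η x ≠ 0)) : testFun u η k m x = 0 := by
  by_cases hx : u x < k
  · have : η x = 0 := by tauto
    rw [testFun, this, zero_pow hm, mul_zero]
  · rw [testFun, max_eq_right (by linarith), zero_mul]

lemma testGrad_eq_zero {u η : Space N → ℝ} {G : Space N → Space N} {k : ℝ} {m : ℕ} (hm : 2 ≤ m)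
    {x : Space N} (h : ¬ (u x < k ∧ η x ≠ 0)) : testGrad u G η k m x = 0 := by
  by_cases hx : u x < k
  · have : η x = 0 := by tauto
    rw [testGrad, this, zero_pow (by omega), zero_pow (by omega)]
    simp
  · rw [testGrad, max_eq_right (by linarith), if_neg hx]
    simp

lemma norm_testGrad_le {u η : Space N → ℝ} {G : Space N → Space N} {k K Λ r : ℝ} {y : Space N}
    {m : ℕ} (hη : IsCutoff η y r Λ) (hK₀ : 0 ≤ K) {x : Space N} (hK : k - u x ≤ K) :
    ‖testGrad u G η k m x‖ ≤ K * m * Λ + if u x < k then η x ^ m * ‖G x‖ else 0 := by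
  have h0 := hη.nonneg x
  refine (norm_sub_le _ _).trans (add_le_add ?_ ?_)
  · rw [norm_smul, Real.norm_of_nonneg (by positivity)]
    calc max (k - u x) 0 * (m * η x ^ (m - 1)) * ‖gradient η x‖ ≤ K * (m * 1) * Λ := by
          gcongr
          · exact max_le hK hK₀
          · exact pow_le_one₀ h0 (hη.le_one x)
          · exact hη.norm_gradient_le x
      _ = K * m * Λ := by ring
  · split_ifs
    · rw [norm_smul, Real.norm_of_nonneg (by positivity)]
    · simp

lemma HasWeakGradient.testFun {Ω : Set (Space N)} (hΩ : IsOpen Ω) {u : Space N → ℝ}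
    {G : Space N → Space N} (h : HasWeakGradient Ω u G) {y : Space N} {r Λ : ℝ} (hr : 0 < r)
    (hball : Metric.closedBall y r ⊆ Ω) (k : ℝ) {η : Space N → ℝ} (hη : IsCutoff η y r Λ) {m : ℕ}
    (hm : m ≠ 0) :
    HasWeakGradient univ (testFun u η k m) (testGrad u G η k m) ∧
      Integrable (testFun u η k m) ∧ Integrable (testGrad u G η k m) := by
  have h1 := h.truncation_mul hΩ hr hball k (hη.contDiff.pow m) (hη.tsupport_pow_subset hm)
  have h2 : (fun x => max (k - u x) 0 • gradient (fun x => η x ^ m) x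
      - if u x < k then η x ^ m • G x else 0) = MixedAnisotropic.testGrad u G η k m := by
    ext1 x
    rw [gradient_pow (hη.contDiff.differentiable (by simp) x), smul_smul]
    rfl
  rw [h2] at h1
  exact h1

lemma memW1pZero_testFun {p : ℝ} {Ω : Set (Space N)} (hΩ : IsOpen Ω) {u : Space N → ℝ}
    {G : Space N → Space N} (h : MemW1pLoc p Ω u G) {y : Space N} {r Λ : ℝ} (hr : 0 < r)
    (hball : Metric.closedBall y r ⊆ Ω) {k K : ℝ} (hK₀ : 0 ≤ K) (hK : ∀ᵐ x, k - u x ≤ K)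
    {η : Space N → ℝ} (hη : IsCutoff η y r Λ) {m : ℕ} (hm : 2 ≤ m) :
    MemW1pZero p (Metric.ball y r) (testFun u η k m) (testGrad u G η k m) := by
  obtain ⟨h1, h2, h3⟩ := h.1.testFun hΩ hr hball k hη (by omega : m ≠ 0)
  have hz : ∀ x ∉ Metric.ball y r, ¬ (u x < k ∧ η x ≠ 0) := fun x hx h => h.2 (hη.eq_zero x hx)
  have hfin : IsFiniteMeasure (volume.restrict (Metric.ball y r)) :=
    ⟨by rw [Measure.restrict_apply_univ]; exact measure_ball_lt_top⟩
  refine ⟨h1, ?_, ?_, Eventually.of_forall fun x hx => testFun_eq_zero (by omega) (hz x hx)⟩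
  · have he : testFun u η k m = (Metric.ball y r).indicator (testFun u η k m) := by
      refine (indicator_eq_self.2 fun x hx => ?_).symm
      by_contra hx'
      exact hx (testFun_eq_zero (by omega) (hz x hx'))
    rw [he, memLp_indicator_iff_restrict measurableSet_ball]
    refine MemLp.of_bound h2.1.restrict K ?_
    filter_upwards [ae_restrict_of_ae hK] with x hx
    have h0 := hη.nonneg x
    rw [testFun, Real.norm_of_nonneg (by positivity)]
    calc max (k - u x) 0 * η x ^ m ≤ K * 1 := by
          gcongr
          · exact max_le hx hK₀
          · exact pow_le_one₀ h0 (hη.le_one x)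
      _ = K := mul_one K
  · have he : testGrad u G η k m = (Metric.ball y r).indicator (testGrad u G η k m) := by
      refine (indicator_eq_self.2 fun x hx => ?_).symm
      by_contra hx'
      exact hx (testGrad_eq_zero hm (hz x hx'))
    rw [he, memLp_indicator_iff_restrict measurableSet_ball]
    have hG : MemLp G (ENNReal.ofReal p) (volume.restrict (Metric.ball y r)) :=
      (h.2 _ (isCompact_closedBall y r) hball).2.mono_measure
        (Measure.restrict_mono Metric.ball_subset_closedBall le_rfl)
    refine MemLp.mono' ((memLp_const (K * m * Λ)).add hG.norm) h3.1.restrict ?_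
    filter_upwards [ae_restrict_of_ae hK] with x hx
    refine (norm_testGrad_le hη hK₀ hx).trans ?_
    simp only [Pi.add_apply]
    gcongr
    split_ifs
    · exact mul_le_of_le_one_left (norm_nonneg _) (pow_le_one₀ (hη.nonneg x) (hη.le_one x))
    · exact norm_nonneg _

lemma integral_indicator_const_of_subset {B E : Set (Space N)} (hE : NullMeasurableSet E)
    (hEB : E ⊆ B) (c : ℝ) :
    ∫ x in B, E.indicator (fun _ => c) x = c * volume.real E := by
  rw [integral_indicator₀ (hE.mono_ac Measure.restrict_le_self.absolutelyContinuous),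
    integral_const, measureReal_restrict_apply_univ, measureReal_def,
    Measure.restrict_eq_self _ hEB, smul_eq_mul, mul_comm, measureReal_def]

/-- The constant in the Caccioppoli estimate. -/
noncomputable def energyConst (N : ℕ) (p s C₁ C₂ K Γ : ℝ) (m : ℕ) : ℝ :=
  2 * ((2 * m * K * C₂) ^ p + 2 * (m * 2 ^ m * K) ^ p * (kernelMass N p s).toReal + Γ * K ^ p)
    / C₁ ^ p

/-- The pointwise Caccioppoli inequality for the local term. -/
lemma local_integrand_le {C₁ C₂ : ℝ} {H : Space N → ℝ} (hH : IsFinslerMinkowski C₁ C₂ H) {p : ℝ}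
    (hp : 1 < p) {m : ℕ} (hm : p ≤ m) {u η : Space N → ℝ} {G : Space N → Space N} {k K Λ r : ℝ}
    {y : Space N} (hη : IsCutoff η y r Λ) (hK₀ : 0 ≤ K) (hΛ : 0 ≤ Λ) {x : Space N}
    (hK : k - u x ≤ K) :
    H (G x) ^ (p - 1) * inner ℝ (gradient H (G x)) (testGrad u G η k m x)
      ≤ {x | u x < k ∧ η x ≠ 0}.indicator (fun _ => (2 * m * K * C₂ * Λ) ^ p) x
        - (1 / 2) * (if u x < k then η x ^ m * H (G x) ^ p else 0) := by
  have hm2 : 2 ≤ m := by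
    have : (1 : ℝ) < m := by linarith
    exact_mod_cast this
  have hC₂ := hH.upper_pos
  by_cases hx : u x < k ∧ η x ≠ 0
  · rw [indicator_of_mem (show x ∈ {x | u x < k ∧ η x ≠ 0} from hx), testGrad, if_pos hx.1,
      if_pos hx.1, max_eq_left (by linarith [hx.1])]
    have h0 := hη.nonneg x
    have hh := hH.nonneg (G x)
    set h := H (G x) with hh'
    have h1 : 0 ≤ k - u x := by linarith [hx.1]
    have hin : inner ℝ (gradient H (G x)) (gradient η x) ≤ C₂ * Λ :=
      ((le_abs_self _).trans (hH.abs_inner_gradient_le _ _)).trans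
        (mul_le_mul_of_nonneg_left (hη.norm_gradient_le x) hC₂.le)
    have hY := pow_mul_rpow_mul_sub_le hp hm h0 (hη.le_one x) hh
      (D := 2 * m * K * C₂ * Λ) (by positivity)
    have hD : 0 ≤ (2 * m * K * C₂ * Λ) ^ p := by positivity
    have hE := hH.rpow_mul_inner_gradient_self hp (G x)
    rw [← hh'] at hE
    have hpm : η x ^ m = η x ^ (m - 1) * η x := by
      rw [← pow_succ, Nat.sub_add_cancel (by omega)]
    have hhp : h ^ p = h ^ (p - 1) * h := by
      rcases hh.eq_or_lt with h3 | h3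
      · rw [← h3, mul_zero, Real.zero_rpow (by linarith)]
      · rw [← Real.rpow_add_one h3.ne', sub_add_cancel]
    have hc : h ^ (p - 1) * ((k - u x) * (m * η x ^ (m - 1)))
        * inner ℝ (gradient H (G x)) (gradient η x)
        ≤ h ^ (p - 1) * (K * (m * η x ^ (m - 1))) * (C₂ * Λ) := by
      calc _ ≤ h ^ (p - 1) * ((k - u x) * (m * η x ^ (m - 1))) * (C₂ * Λ) := by gcongr
        _ ≤ _ := by gcongr
    rw [inner_sub_right, inner_smul_right, inner_smul_right]
    calc h ^ (p - 1) * ((k - u x) * (m * η x ^ (m - 1)) * inner ℝ (gradient H (G x)) (gradient η x)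
          - η x ^ m * inner ℝ (gradient H (G x)) (G x))
        = h ^ (p - 1) * ((k - u x) * (m * η x ^ (m - 1)))
            * inner ℝ (gradient H (G x)) (gradient η x)
          - η x ^ m * (h ^ (p - 1) * inner ℝ (gradient H (G x)) (G x)) := by ring
      _ ≤ h ^ (p - 1) * (K * (m * η x ^ (m - 1))) * (C₂ * Λ) - η x ^ m * h ^ p := by
          rw [hE]; linarith
      _ = (1 / 2) * (η x ^ (m - 1) * h ^ (p - 1) * (2 * m * K * C₂ * Λ - η x * h))
          - (1 / 2) * (η x ^ m * h ^ p) := by rw [hhp, hpm]; ring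
      _ ≤ _ := by linarith
  · rw [testGrad_eq_zero hm2 hx, inner_zero_right, mul_zero, indicator_of_notMem (by exact hx)]
    have : (if u x < k then η x ^ m * H (G x) ^ p else 0) = 0 := by
      split_ifs with h
      · have : η x = 0 := by tauto
        rw [this, zero_pow (by omega), zero_mul]
      · rfl
    rw [this]; simp

/-- The Caccioppoli estimate for a supersolution. Only bounds of `u` on `{u < k}` enter, and the
right-hand side is linear in the measure of the set that carries the test function. -/
lemma caccioppoli (hN : 2 ≤ N) {p s : ℝ} (hp : 1 < p) (hs₀ : 0 < s) (hs₁ : s < 1) {m : ℕ}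
    (hm : p ≤ m) {C₁ C₂ : ℝ} {H : Space N → ℝ} (hH : IsFinslerMinkowski C₁ C₂ H) {ε : ℝ}
    (hε₀ : 0 < ε) (hε₁ : ε ≤ 1) {Ω : Set (Space N)} (hΩ : IsOpen Ω) {g u : Space N → ℝ} {Γ : ℝ}
    (hΓ : 0 ≤ Γ) (hg : ∀ᵐ x ∂volume.restrict Ω, |g x| ≤ Γ) (hum : AEStronglyMeasurable u volume)
    {G : Space N → Space N} (hu : MemW1pLoc p Ω u G)
    (hsup : ∀ Ω' : Set (Space N), IsOpen Ω' → IsCompact (closure Ω') → closure Ω' ⊆ Ω →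
      ∀ (φ : Space N → ℝ) (Φ : Space N → Space N), MemW1pZero p Ω' φ Φ → (∀ᵐ x, 0 ≤ φ x) →
        0 ≤ localForm p H Ω' G Φ + ε * nonlocalForm p s u φ
          - ∫ x in Ω', g x * |u x| ^ (p - 2) * u x * φ x)
    {y : Space N} {r Λ : ℝ} (hr : 0 < r) (hball : Metric.closedBall y r ⊆ Ω) {η : Space N → ℝ}
    (hη : IsCutoff η y r Λ) (hΛ : 1 ≤ Λ) {k K : ℝ} (hK₀ : 0 ≤ K) (hK : ∀ᵐ x, k - u x ≤ K)
    (hK' : ∀ᵐ x, u x < k → |u x| ≤ K) :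
    IntegrableOn (fun x => if u x < k then η x ^ m * ‖G x‖ ^ p else 0) (Metric.ball y r) ∧
      ∫ x in Metric.ball y r, (if u x < k then η x ^ m * ‖G x‖ ^ p else 0)
        ≤ energyConst N p s C₁ C₂ K Γ m * Λ ^ p * volume.real {x | u x < k ∧ η x ≠ 0} := by
  have hm2 : 2 ≤ m := by
    have : (1 : ℝ) < m := by linarith
    exact_mod_cast this
  have hp0 : 0 < p := by linarith
  have hC₁ := hH.lower_pos
  have hC₂ := hH.upper_pos
  have hΛ0 : 0 ≤ Λ := by linarith
  set B := Metric.ball y r with hB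
  set E := {x | u x < k ∧ η x ≠ 0} with hE
  have hEB : E ⊆ B := fun x hx => by
    by_contra h; exact hx.2 (hη.eq_zero x h)
  have hA : NullMeasurableSet {x | u x < k} volume :=
    nullMeasurableSet_lt hum.aemeasurable aemeasurable_const
  have hEm : NullMeasurableSet E volume :=
    hA.inter (hη.contDiff.continuous.measurable (measurableSet_singleton 0).compl).nullMeasurableSet
  have hAB : NullMeasurableSet {x | u x < k} (volume.restrict B) :=
    hA.mono_ac Measure.restrict_le_self.absolutelyContinuous
  have hfinB : IsFiniteMeasure (volume.restrict B) :=
    ⟨by rw [Measure.restrict_apply_univ]; exact measure_ball_lt_top⟩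
  have hEfin : volume E ≠ ⊤ := measure_ne_top_of_subset hEB measure_ball_lt_top.ne
  have hGp : MemLp G (ENNReal.ofReal p) (volume.restrict B) :=
    (hu.2 _ (isCompact_closedBall y r) hball).2.mono_measure
      (Measure.restrict_mono Metric.ball_subset_closedBall le_rfl)
  have hGm := hGp.1
  have hGi : Integrable (fun x => ‖G x‖ ^ p) (volume.restrict B) := by
    have := hGp.integrable_norm_rpow (by simpa using hp0) ENNReal.ofReal_ne_top
    rwa [ENNReal.toReal_ofReal hp0.le] at this
  have hHc : Continuous H := hH.lipschitzWith.continuous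
  have hηm : Continuous fun x => η x ^ m := hη.contDiff.continuous.pow m
  have hηle : ∀ x, η x ^ m ≤ 1 := fun x => pow_le_one₀ (hη.nonneg x) (hη.le_one x)
  have hη0 : ∀ x, 0 ≤ η x ^ m := fun x => pow_nonneg (hη.nonneg x) m
  have hHp : ∀ x, H (G x) ^ p ≤ C₂ ^ p * ‖G x‖ ^ p := fun x => by
    rw [← Real.mul_rpow hC₂.le (norm_nonneg _)]
    exact Real.rpow_le_rpow (hH.nonneg _) (hH.upper_bound _) hp0.le
  -- integrability of the weighted energies
  have hind : ∀ f : Space N → ℝ, AEStronglyMeasurable f (volume.restrict B) →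
      AEStronglyMeasurable (fun x => if u x < k then f x else 0) (volume.restrict B) := by
    intro f hf
    have : (fun x => if u x < k then f x else 0) = {x | u x < k}.indicator f := by
      ext x; simp [indicator]
    rw [this]; exact hf.indicator₀ hAB
  have hWi : Integrable (fun x => if u x < k then η x ^ m * ‖G x‖ ^ p else 0)
      (volume.restrict B) := by
    refine hGi.mono' (hind _ (hηm.aestronglyMeasurable.mul hGi.1))
      (Eventually.of_forall fun x => ?_)
    split_ifs
    · rw [Real.norm_of_nonneg (mul_nonneg (hη0 x) (by positivity))]
      exact mul_le_of_le_one_left (by positivity) (hηle x)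
    · rw [norm_zero]; positivity
  have hHGm : AEStronglyMeasurable (fun x => H (G x)) (volume.restrict B) :=
    hHc.comp_aestronglyMeasurable hGm
  have hHpm : ∀ q : ℝ, AEStronglyMeasurable (fun x => H (G x) ^ q) (volume.restrict B) := fun q =>
    (hHGm.aemeasurable.pow_const q).aestronglyMeasurable
  have hZi : Integrable (fun x => if u x < k then η x ^ m * H (G x) ^ p else 0)
      (volume.restrict B) := by
    refine (hGi.const_mul (C₂ ^ p)).mono' (hind _ (hηm.aestronglyMeasurable.mul (hHpm p)))
      (Eventually.of_forall fun x => ?_)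
    have hh : 0 ≤ H (G x) ^ p := Real.rpow_nonneg (hH.nonneg _) _
    split_ifs
    · rw [Real.norm_of_nonneg (mul_nonneg (hη0 x) hh)]
      exact (mul_le_of_le_one_left hh (hηle x)).trans (hHp x)
    · rw [norm_zero]; positivity
  -- integrability of the local form
  have htest := memW1pZero_testFun hΩ hu hr hball hK₀ hK hη hm2
  have hΦm : AEStronglyMeasurable (testGrad u G η k m) (volume.restrict B) := htest.2.2.1.1.restrict
  have hgradm : AEStronglyMeasurable (fun x => gradient H (G x)) (volume.restrict B) := by
    have h1 : Measurable (gradient H) :=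
      (InnerProductSpace.toDual ℝ (Space N)).symm.continuous.measurable.comp (measurable_fderiv ℝ H)
    exact (h1.comp_aemeasurable hGm.aemeasurable).aestronglyMeasurable
  have hXi : Integrable (fun x => H (G x) ^ (p - 1) *
      inner ℝ (gradient H (G x)) (testGrad u G η k m x)) (volume.restrict B) := by
    have hbd : Integrable (fun x => C₂ ^ p * (K * m * Λ) * (1 + ‖G x‖ ^ p) + C₂ ^ p * ‖G x‖ ^ p)
        (volume.restrict B) :=
      (((integrable_const 1).add hGi).const_mul _).add (hGi.const_mul _)
    refine hbd.mono' ((hHpm (p - 1)).mul (hgradm.inner hΦm)) ?_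
    filter_upwards [ae_restrict_of_ae hK] with x hx
    have ht := norm_nonneg (G x)
    have h1 : H (G x) ^ (p - 1) ≤ C₂ ^ (p - 1) * ‖G x‖ ^ (p - 1) := by
      rw [← Real.mul_rpow hC₂.le ht]
      exact Real.rpow_le_rpow (hH.nonneg _) (hH.upper_bound _) (by linarith)
    have h2 : ‖testGrad u G η k m x‖ ≤ K * m * Λ + ‖G x‖ := by
      refine (norm_testGrad_le hη hK₀ hx).trans ?_
      gcongr
      split_ifs
      · exact mul_le_of_le_one_left ht (hηle x)
      · exact ht
    have h3 : C₂ ^ p = C₂ ^ (p - 1) * C₂ := by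
      rw [← Real.rpow_add_one hC₂.ne', sub_add_cancel]
    have h4 : ‖G x‖ ^ p = ‖G x‖ ^ (p - 1) * ‖G x‖ := by
      rcases ht.eq_or_lt with h | h
      · rw [← h, mul_zero, Real.zero_rpow hp0.ne']
      · rw [← Real.rpow_add_one h.ne', sub_add_cancel]
    have h5 : ‖G x‖ ^ (p - 1) ≤ 1 + ‖G x‖ ^ p := by
      rcases le_total ‖G x‖ 1 with h | h
      · have := Real.rpow_le_one ht h (by linarith : 0 ≤ p - 1)
        have : 0 ≤ ‖G x‖ ^ p := by positivity
        linarith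
      · have := Real.rpow_le_rpow_of_exponent_le h (by linarith : p - 1 ≤ p)
        linarith
    rw [norm_mul, Real.norm_of_nonneg (Real.rpow_nonneg (hH.nonneg _) _), Real.norm_eq_abs]
    calc H (G x) ^ (p - 1) * |inner ℝ (gradient H (G x)) (testGrad u G η k m x)|
        ≤ (C₂ ^ (p - 1) * ‖G x‖ ^ (p - 1)) * (C₂ * (K * m * Λ + ‖G x‖)) := by
          gcongr
          exact (hH.abs_inner_gradient_le _ _).trans (by gcongr)
      _ = C₂ ^ p * (K * m * Λ) * ‖G x‖ ^ (p - 1) + C₂ ^ p * ‖G x‖ ^ p := by rw [h3, h4]; ring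
      _ ≤ _ := by gcongr
  -- the three terms of the weak inequality
  have hind2 : ∀ c : ℝ, Integrable (E.indicator fun _ => c) (volume.restrict B) := fun c =>
    (integrable_const c).indicator₀ (hEm.mono_ac Measure.restrict_le_self.absolutelyContinuous)
  have hloc : localForm p H B G (testGrad u G η k m)
      ≤ (2 * m * K * C₂ * Λ) ^ p * volume.real E
        - (1 / 2) * ∫ x in B, (if u x < k then η x ^ m * H (G x) ^ p else 0) := by
    rw [← integral_indicator_const_of_subset hEm hEB, ← integral_const_mul,
      ← integral_sub (hind2 _) (hZi.const_mul _)]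
    refine integral_mono_ae hXi ((hind2 _).sub (hZi.const_mul _)) ?_
    filter_upwards [ae_restrict_of_ae hK] with x hx
    exact local_integrand_le hH hp hm hη hK₀ hΛ0 hx
  have hnl : ε * nonlocalForm p s u (testFun u η k m)
      ≤ 2 * (m * 2 ^ m * K) ^ p * (kernelMass N p s).toReal * Λ ^ p * volume.real E := by
    have h1 := nonlocalForm_le hN hp hs₀ hs₁ hm hK₀ hK hη.nonneg hη.le_one hΛ hη.abs_sub_le hEfin
      (fun x hx => testFun_eq_zero (by omega) hx)
    have h2 : 0 ≤ 2 * (m * 2 ^ m * K) ^ p * (kernelMass N p s).toReal * Λ ^ p * volume.real E := by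
      positivity
    calc _ ≤ ε * (2 * (m * 2 ^ m * K) ^ p * (kernelMass N p s).toReal * Λ ^ p * volume.real E) :=
          mul_le_mul_of_nonneg_left h1 hε₀.le
      _ ≤ _ := mul_le_of_le_one_left h2 hε₁
  have hsrc : - ∫ x in B, g x * |u x| ^ (p - 2) * u x * testFun u η k m x
      ≤ Γ * K ^ p * volume.real E := by
    rw [← integral_indicator_const_of_subset hEm hEB]
    refine (neg_le_abs _).trans ?_
    rw [← Real.norm_eq_abs]
    refine norm_integral_le_of_norm_le (hind2 (Γ * K ^ p)) ?_
    have hBΩ : B ⊆ Ω := Metric.ball_subset_closedBall.trans hball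
    filter_upwards [ae_restrict_of_ae hK, ae_restrict_of_ae hK',
      ae_restrict_of_ae_restrict_of_subset hBΩ hg] with x h1 h2 h3
    by_cases hx : u x < k ∧ η x ≠ 0
    · rw [indicator_of_mem (show x ∈ E from hx), testFun, max_eq_left (by linarith [hx.1])]
      have h4 := h2 hx.1
      have h5 : |u x| ^ (p - 2) * |u x| ≤ K ^ (p - 1) := by
        rcases (abs_nonneg (u x)).eq_or_lt with h | h
        · rw [← h, mul_zero]; positivity
        · rw [← Real.rpow_add_one h.ne']
          have : p - 2 + 1 = p - 1 := by ring
          rw [this]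
          exact Real.rpow_le_rpow h.le h4 (by linarith)
      have h6 : K ^ p = K ^ (p - 1) * K := by
        rcases hK₀.eq_or_lt with h | h
        · rw [← h, mul_zero, Real.zero_rpow hp0.ne']
        · rw [← Real.rpow_add_one h.ne', sub_add_cancel]
      have h7 : 0 ≤ k - u x := by linarith [hx.1]
      rw [Real.norm_eq_abs, abs_mul, abs_mul, abs_mul, abs_mul,
        abs_of_nonneg (Real.rpow_nonneg (abs_nonneg (u x)) _), abs_of_nonneg h7,
        abs_of_nonneg (hη0 x)]
      calc |g x| * |u x| ^ (p - 2) * |u x| * ((k - u x) * η x ^ m)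
          = |g x| * (|u x| ^ (p - 2) * |u x|) * ((k - u x) * η x ^ m) := by ring
        _ ≤ Γ * K ^ (p - 1) * (K * 1) := by
            gcongr
            · exact mul_nonneg h7 (hη0 x)
            · exact hη0 x
            · exact hηle x
        _ = Γ * K ^ p := by rw [h6]; ring
    · rw [indicator_of_notMem (show x ∉ E from hx), testFun_eq_zero (by omega) hx, mul_zero,
        norm_zero]
  have hcl : closure B ⊆ Metric.closedBall y r := Metric.closure_ball_subset_closedBall
  have hmain := hsup B Metric.isOpen_ball
    ((isCompact_closedBall y r).of_isClosed_subset isClosed_closure hcl) (hcl.trans hball)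
    _ _ htest (Eventually.of_forall fun x => mul_nonneg (le_max_right _ _) (hη0 x))
  -- comparison of the Finsler energy with the Euclidean one
  have hWZ : C₁ ^ p * ∫ x in B, (if u x < k then η x ^ m * ‖G x‖ ^ p else 0)
      ≤ ∫ x in B, (if u x < k then η x ^ m * H (G x) ^ p else 0) := by
    rw [← integral_const_mul]
    refine integral_mono (hWi.const_mul _) hZi fun x => ?_
    simp only
    split_ifs
    · calc C₁ ^ p * (η x ^ m * ‖G x‖ ^ p) = η x ^ m * (C₁ * ‖G x‖) ^ p := by
            rw [Real.mul_rpow hC₁.le (norm_nonneg _)]; ring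
        _ ≤ η x ^ m * H (G x) ^ p := by
            have := hη0 x
            gcongr
            exact hH.lower_bound _
    · simp
  refine ⟨hWi, ?_⟩
  have hC₁p : 0 < C₁ ^ p := by positivity
  have hΛp : 1 ≤ Λ ^ p := Real.one_le_rpow hΛ hp0.le
  have hΓK : Γ * K ^ p * volume.real E ≤ Γ * K ^ p * volume.real E * Λ ^ p :=
    le_mul_of_one_le_right (by positivity) hΛp
  have hD : (2 * m * K * C₂ * Λ) ^ p = (2 * m * K * C₂) ^ p * Λ ^ p :=
    Real.mul_rpow (by positivity) hΛ0
  rw [hD] at hloc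
  rw [energyConst, div_mul_eq_mul_div, div_mul_eq_mul_div, le_div_iff₀ hC₁p]
  nlinarith [hloc, hnl, hsrc, hmain, hWZ, hΓK]

end Caccioppoli

/-! ### De Giorgi iteration -/

section DeGiorgi

variable {N : ℕ}

/-- From the energy estimate to an `L¹` estimate of the gradient of the test function. Instead of
Hölder's inequality, `t ≤ Λ ^ (1 - p) t ^ p + Λ` is used. -/
lemma lintegral_testGrad_le {p : ℝ} (hp : 1 < p) {m : ℕ} (hm : 2 ≤ m) {u η : Space N → ℝ}
    (hum : AEStronglyMeasurable u volume) {G : Space N → Space N} {y : Space N} {r Λ k K C : ℝ}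
    (hη : IsCutoff η y r Λ) (hΛ : 1 ≤ Λ) (hK₀ : 0 ≤ K) (hK : ∀ᵐ x, k - u x ≤ K)
    (hint : Integrable (testGrad u G η k m))
    (hWi : IntegrableOn (fun x => if u x < k then η x ^ m * ‖G x‖ ^ p else 0) (Metric.ball y r))
    (hW : ∫ x in Metric.ball y r, (if u x < k then η x ^ m * ‖G x‖ ^ p else 0)
      ≤ C * Λ ^ p * volume.real {x | u x < k ∧ η x ≠ 0}) :
    ∫⁻ x, ‖testGrad u G η k m x‖ₑ
      ≤ ENNReal.ofReal ((K * m + 1 + C) * Λ * volume.real {x | u x < k ∧ η x ≠ 0}) := by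
  have hΛ0 : 0 < Λ := by linarith
  set B := Metric.ball y r with hB
  set E := {x | u x < k ∧ η x ≠ 0} with hE
  have hEB : E ⊆ B := fun x hx => by
    by_contra h; exact hx.2 (hη.eq_zero x h)
  have hEm : NullMeasurableSet E volume :=
    (nullMeasurableSet_lt hum.aemeasurable aemeasurable_const).inter
      (hη.contDiff.continuous.measurable (measurableSet_singleton 0).compl).nullMeasurableSet
  have hfinB : IsFiniteMeasure (volume.restrict B) :=
    ⟨by rw [Measure.restrict_apply_univ]; exact measure_ball_lt_top⟩
  rw [← ofReal_integral_norm_eq_lintegral_enorm hint]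
  refine ENNReal.ofReal_le_ofReal ?_
  rw [← setIntegral_eq_integral_of_forall_compl_eq_zero (s := B) fun x hx => by
    rw [testGrad_eq_zero hm fun h => h.2 (hη.eq_zero x hx), norm_zero]]
  have hind : Integrable (E.indicator fun _ => (K * m + 1) * Λ) (volume.restrict B) :=
    (integrable_const _).indicator₀ (hEm.mono_ac Measure.restrict_le_self.absolutelyContinuous)
  calc ∫ x in B, ‖testGrad u G η k m x‖
      ≤ ∫ x in B, (E.indicator (fun _ => (K * m + 1) * Λ) x
          + Λ ^ (1 - p) * if u x < k then η x ^ m * ‖G x‖ ^ p else 0) := by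
        refine integral_mono_ae hint.norm.integrableOn (hind.add (hWi.const_mul _)) ?_
        filter_upwards [ae_restrict_of_ae hK] with x hx
        by_cases hxE : u x < k ∧ η x ≠ 0
        · rw [indicator_of_mem (show x ∈ E from hxE)]
          refine (norm_testGrad_le hη hK₀ hx).trans ?_
          rw [if_pos hxE.1, if_pos hxE.1]
          have hη0 : 0 ≤ η x ^ m := pow_nonneg (hη.nonneg x) m
          have hη1 : η x ^ m ≤ 1 := pow_le_one₀ (hη.nonneg x) (hη.le_one x)
          have ht := norm_nonneg (G x)
          have key : ‖G x‖ ≤ Λ ^ (1 - p) * ‖G x‖ ^ p + Λ := by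
            rcases le_total ‖G x‖ Λ with h | h
            · have : 0 ≤ Λ ^ (1 - p) * ‖G x‖ ^ p := by positivity
              linarith
            · have hpos : 0 < ‖G x‖ := hΛ0.trans_le h
              have h1 : Λ ^ (1 - p) * ‖G x‖ ^ (p - 1) ≥ 1 := by
                calc Λ ^ (1 - p) * ‖G x‖ ^ (p - 1) ≥ Λ ^ (1 - p) * Λ ^ (p - 1) := by
                      gcongr
                  _ = 1 := by rw [← Real.rpow_add hΛ0]; simp
              have h2 : ‖G x‖ ^ p = ‖G x‖ ^ (p - 1) * ‖G x‖ := by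
                rw [← Real.rpow_add_one hpos.ne', sub_add_cancel]
              rw [h2]
              nlinarith
          calc K * m * Λ + η x ^ m * ‖G x‖
              ≤ K * m * Λ + η x ^ m * (Λ ^ (1 - p) * ‖G x‖ ^ p + Λ) := by gcongr
            _ ≤ _ := by nlinarith
        · rw [testGrad_eq_zero hm hxE, norm_zero, indicator_of_notMem (show x ∉ E from hxE)]
          have h0 : 0 ≤ if u x < k then η x ^ m * ‖G x‖ ^ p else 0 := by
            split_ifs
            · exact mul_nonneg (pow_nonneg (hη.nonneg x) m) (by positivity)
            · exact le_rfl
          positivity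
    _ = (K * m + 1) * Λ * volume.real E
          + Λ ^ (1 - p) * ∫ x in B, (if u x < k then η x ^ m * ‖G x‖ ^ p else 0) := by
        rw [integral_add hind (hWi.const_mul _), integral_indicator_const_of_subset hEm hEB,
          integral_const_mul]
    _ ≤ (K * m + 1) * Λ * volume.real E + Λ ^ (1 - p) * (C * Λ ^ p * volume.real E) := by gcongr
    _ = (K * m + 1 + C) * Λ * volume.real E := by
        have : Λ ^ (1 - p) * Λ ^ p = Λ := by rw [← Real.rpow_add hΛ0]; simp
        linear_combination C * volume.real E * this

/-- The Sobolev constant for `W^{1,1}(ℝ^N)`. -/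
noncomputable def sobolevConst (N : ℕ) : ℝ :=
  eLpNormLESNormFDerivOneConst (volume : Measure (Space N)) (sobolevExponent N)

/-- Sobolev's and Chebyshev's inequalities bound the measure of a smaller sublevel set by a
power, larger than one, of the measure of a larger sublevel set. -/
lemma measureReal_sublevel_le (hN : 2 ≤ N) {m : ℕ} (hm : m ≠ 0) {u η : Space N → ℝ}
    {G : Space N → Space N} {y : Space N} {r Λ k k' D : ℝ} (hη : IsCutoff η y r Λ) (hk : k' < k)
    (hD : 0 ≤ D) (hw : HasWeakGradient univ (testFun u η k m) (testGrad u G η k m))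
    (hi₁ : Integrable (testFun u η k m)) (hi₂ : Integrable (testGrad u G η k m))
    (hgrad : ∫⁻ x, ‖testGrad u G η k m x‖ₑ ≤ ENNReal.ofReal D) {E' : Set (Space N)}
    (hE' : ∀ x ∈ E', u x < k' ∧ η x = 1) :
    volume.real E' ≤ (sobolevConst N * D / (k - k')) ^ (sobolevExponent N : ℝ) := by
  have hq0 : 0 < sobolevExponent N := (holderConjugate_sobolevExponent hN).symm.pos
  have hkk : 0 < k - k' := sub_pos.2 hk
  have hS : 0 ≤ sobolevConst N := NNReal.coe_nonneg _
  have hcs : HasCompactSupport (testFun u η k m) := by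
    refine HasCompactSupport.of_support_subset_isCompact (isCompact_closedBall y r) fun x hx => ?_
    by_contra hx'
    exact hx (testFun_eq_zero hm fun h =>
      h.2 (hη.eq_zero x fun h => hx' (Metric.ball_subset_closedBall h)))
  have hnorm : eLpNorm (testFun u η k m) (sobolevExponent N) volume
      ≤ ENNReal.ofReal (sobolevConst N * D) := by
    refine (hw.eLpNorm_le hN hi₁ hi₂ hcs).trans ?_
    rw [ENNReal.ofReal_mul hS, sobolevConst, ENNReal.ofReal_coe_nnreal]
    gcongr
  have hmeas : volume E' ≤ ENNReal.ofReal ((sobolevConst N * D / (k - k'))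
      ^ (sobolevExponent N : ℝ)) := by
    calc volume E' ≤ volume {x | ENNReal.ofReal (k - k') ≤ ‖testFun u η k m x‖ₑ} := by
          refine measure_mono fun x hx => ?_
          obtain ⟨h1, h2⟩ := hE' x hx
          simp only [mem_ofPred_eq]
          rw [testFun, h2, one_pow, mul_one, max_eq_left (by linarith),
            Real.enorm_of_nonneg (by linarith)]
          exact ENNReal.ofReal_le_ofReal (by linarith)
      _ ≤ (ENNReal.ofReal (k - k'))⁻¹ ^ (sobolevExponent N : ℝ≥0∞).toReal
            * eLpNorm (testFun u η k m) (sobolevExponent N) volume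
              ^ (sobolevExponent N : ℝ≥0∞).toReal := by
          refine meas_ge_le_mul_pow_eLpNorm_enorm volume (by exact_mod_cast hq0.ne')
            ENNReal.coe_ne_top hi₁.1 ?_ (fun h => absurd h ENNReal.ofReal_ne_top)
          exact (ENNReal.ofReal_pos.2 hkk).ne'
      _ ≤ (ENNReal.ofReal (k - k'))⁻¹ ^ (sobolevExponent N : ℝ)
            * ENNReal.ofReal (sobolevConst N * D) ^ (sobolevExponent N : ℝ) := by
          rw [ENNReal.coe_toReal]
          gcongr
      _ = _ := by
          rw [← ENNReal.mul_rpow_of_nonneg _ _ (NNReal.coe_nonneg _),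
            ← ENNReal.ofReal_inv_of_pos hkk, ← ENNReal.ofReal_mul (by positivity),
            ENNReal.ofReal_rpow_of_nonneg (by positivity) (NNReal.coe_nonneg _)]
          congr 2
          field_simp
  exact ENNReal.toReal_le_of_le_ofReal (by positivity) hmeas

/-- Fast geometric convergence: a superlinear recursion with a small initial value tends to `0`. -/
lemma exists_tendsto_zero_of_le_rpow {q A : ℝ} (hq : 1 < q) (hA : 0 < A) :
    ∃ δ : ℝ, 0 < δ ∧ ∀ Y : ℕ → ℝ, (∀ j, 0 ≤ Y j) → Y 0 ≤ δ →
      (∀ j, Y (j + 1) ≤ (A * 4 ^ j * Y j) ^ q) → Tendsto Y atTop (𝓝 0) := by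
  have hq1 : 0 < q - 1 := sub_pos.2 hq
  -- `θ` and `δ` are chosen such that `δ θ ^ j` solves the recursion with equality
  set θ : ℝ := 4 ^ (-(q / (q - 1))) with hθ
  have hθ0 : 0 < θ := by positivity
  have hθ1 : θ < 1 :=
    Real.rpow_lt_one_of_one_lt_of_neg (by norm_num) (by simp only [neg_lt_zero]; positivity)
  have h4θ : (4 * θ) ^ q = θ := by
    rw [Real.mul_rpow (by norm_num) hθ0.le, hθ, ← Real.rpow_mul (by norm_num),
      ← Real.rpow_add (by norm_num)]
    congr 1
    field_simp
    ring
  set δ : ℝ := (θ * A ^ (-q)) ^ (1 / (q - 1)) with hδ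
  have hδ0 : 0 < δ := by positivity
  have hAδ : (A * δ) ^ q = θ * δ := by
    have h1 : δ ^ (q - 1) = θ * A ^ (-q) := by
      rw [hδ, ← Real.rpow_mul (by positivity), one_div_mul_cancel hq1.ne', Real.rpow_one]
    have h2 : δ ^ q = δ ^ (q - 1) * δ := by rw [← Real.rpow_add_one hδ0.ne', sub_add_cancel]
    have h3 : A ^ q * A ^ (-q) = 1 := by rw [← Real.rpow_add hA]; simp
    rw [Real.mul_rpow hA.le hδ0.le, h2, h1]
    linear_combination θ * δ * h3
  refine ⟨δ, hδ0, fun Y hY0 hYδ hY => ?_⟩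
  have hb : ∀ j, Y j ≤ δ * θ ^ j := by
    intro j
    induction j with
    | zero => simpa using hYδ
    | succ j ih =>
      calc Y (j + 1) ≤ (A * 4 ^ j * Y j) ^ q := hY j
        _ ≤ (A * 4 ^ j * (δ * θ ^ j)) ^ q := by
            have := hY0 j
            gcongr
        _ = ((A * δ) * (4 * θ) ^ j) ^ q := by rw [mul_pow]; ring_nf
        _ = (A * δ) ^ q * ((4 * θ) ^ q) ^ j := by
            rw [Real.mul_rpow (by positivity) (by positivity), ← Real.rpow_natCast,
              ← Real.rpow_natCast, ← Real.rpow_mul (by positivity), ← Real.rpow_mul (by positivity),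
              mul_comm (j : ℝ) q]
        _ = δ * θ ^ (j + 1) := by rw [hAδ, h4θ]; ring
  have hlim : Tendsto (fun j => δ * θ ^ j) atTop (𝓝 0) := by
    simpa using (tendsto_pow_atTop_nhds_zero_of_lt_one hθ0.le hθ1).const_mul δ
  exact squeeze_zero hY0 hb hlim

lemma one_lt_sobolevExponent (hN : 2 ≤ N) : (1 : ℝ) < sobolevExponent N := by
  exact_mod_cast (holderConjugate_sobolevExponent hN).symm.lt

lemma sub_one_mul_sobolevExponent (hN : 2 ≤ N) : ((N : ℝ) - 1) * sobolevExponent N = N := by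
  have h := (holderConjugate_sobolevExponent hN).coe.sub_one_mul_conj
  simpa using h

/-- Property `(𝒟)` with a constant that depends only on the data. -/
theorem exists_deGiorgiProperty (hN : 2 ≤ N) {p s : ℝ} (hp : 1 < p) (hs₀ : 0 < s) (hs₁ : s < 1)
    (C₁ C₂ b M μ lam Γ : ℝ) (hb₁ : b < 1) (hM : 0 < M) :
    ∃ τ : ℝ, 0 < τ ∧ τ < 1 ∧ ∀ (Ω : Set (Space N)) (g H u : Space N → ℝ) (ε : ℝ), IsOpen Ω →
      (∀ᵐ x ∂volume.restrict Ω, |g x| ≤ Γ) → IsFinslerMinkowski C₁ C₂ H → 0 < ε → ε ≤ 1 →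
      IsWeakSupersolution p s ε H g Ω u → (∀ᵐ x, lam ≤ u x) →
        DeGiorgiProperty Ω u b (3 / 4) M μ τ := by
  obtain ⟨K₀, hK₀, hcut⟩ := exists_cutoff
  set m := ⌈p⌉₊ with hm_def
  have hm : p ≤ m := Nat.le_ceil p
  have hm2 : 2 ≤ m := by
    have : (1 : ℝ) < m := by linarith
    exact_mod_cast this
  set K : ℝ := |lam| + |μ| + M with hK_def
  have hK0 : 0 ≤ K := by positivity
  set q : ℝ := (sobolevExponent N : ℝ) with hq_def
  have hq : 1 < q := one_lt_sobolevExponent hN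
  set C : ℝ := energyConst N p s C₁ C₂ K (max Γ 0) m with hC_def
  set A : ℝ := max 1 (sobolevConst N * ((K * m + 1 + C) * (8 * K₀)) * 2 / ((1 - b) * M)) with hA
  have hA0 : 0 < A := lt_of_lt_of_le one_pos (le_max_left _ _)
  have hb' : 0 < (1 - b) * M := mul_pos (sub_pos.2 hb₁) hM
  obtain ⟨δ, hδ0, hδ⟩ := exists_tendsto_zero_of_le_rpow hq hA0
  set vB : ℝ := volume.real (Metric.ball (0 : Space N) 1) with hvB
  have hvB0 : 0 < vB := ENNReal.toReal_pos (Metric.measure_ball_pos volume _ one_pos).ne'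
    measure_ball_lt_top.ne
  have hδvB : 0 < δ / vB := by positivity
  refine ⟨min (1 / 2) (δ / vB), by positivity, (min_le_left _ _).trans_lt (by norm_num), ?_⟩
  rintro Ω g H u ε hΩ hg hH hε₀ hε₁ ⟨⟨hum, -, -⟩, G, hu, hsup⟩ hlam y r hr hr1 hball - hsmall
  have hC0 : 0 ≤ C := by
    have := hH.lower_pos
    have := hH.upper_pos
    have : 0 ≤ max Γ 0 := le_max_right _ _
    rw [hC_def, energyConst]; positivity
  -- the radii `ρ j` decrease from `r` to `3 r / 4`, the levels `κ j` from `μ + M` to `μ + b M`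
  set e : ℕ → ℝ := fun j => (1 / 2) ^ j with he
  have he0 : ∀ j, 0 < e j := fun j => by positivity
  have he1 : ∀ j, e j ≤ 1 := fun j => pow_le_one₀ (by norm_num) (by norm_num)
  have hes : ∀ j, e (j + 1) = e j / 2 := fun j => by simp only [he, pow_succ]; ring
  set ρ : ℕ → ℝ := fun j => 3 / 4 * r + r / 4 * e j with hρ
  set κ : ℕ → ℝ := fun j => μ + b * M + (1 - b) * M * e j with hκ
  set S : ℕ → Set (Space N) := fun j => {x | u x < κ j} ∩ Metric.ball y (ρ j) with hS
  have hSfin : ∀ j, volume (S j) ≠ ⊤ := fun j =>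
    measure_ne_top_of_subset inter_subset_right measure_ball_lt_top.ne
  have hρr : ∀ j, ρ j ≤ r := fun j => by
    simp only [hρ]; nlinarith [he1 j]
  have hκM : ∀ j, κ j ≤ μ + M := fun j => by
    simp only [hκ]; nlinarith [he1 j]
  have hkK : ∀ j, ∀ᵐ x, κ j - u x ≤ K := fun j => by
    filter_upwards [hlam] with x hx
    linarith [hκM j, neg_le_abs lam, le_abs_self μ]
  have hkK' : ∀ j, ∀ᵐ x, u x < κ j → |u x| ≤ K := fun j => by
    filter_upwards [hlam] with x hx hxk
    rw [abs_le]
    constructor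
    · linarith [neg_abs_le lam, abs_nonneg μ]
    · linarith [hκM j, le_abs_self μ, abs_nonneg lam]
  -- one step of the iteration
  have hstep : ∀ j, volume.real (S (j + 1)) ≤ (A * 4 ^ j * (volume.real (S j) / r)) ^ q := by
    intro j
    have hρd : ρ j - ρ (j + 1) = r / 8 * e j := by simp only [hρ, hes]; ring
    have hρ' : ρ (j + 1) < ρ j := by
      have := mul_pos (div_pos hr (by norm_num : (0 : ℝ) < 8)) (he0 j)
      linarith
    have hρ0 : 0 < ρ (j + 1) := by
      have := he0 (j + 1)
      simp only [hρ]; positivity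
    obtain ⟨η, hη1, hη2, hη3, hη4, hη5, hη6⟩ := hcut N y (ρ (j + 1)) (ρ j) hρ0 hρ'
    set Λ := K₀ / (ρ j - ρ (j + 1)) with hΛ
    have hΛe : Λ = 8 * K₀ / (r * e j) := by
      rw [hΛ, hρd]; have := he0 j; field_simp
    have hΛ1 : 1 ≤ Λ := by
      rw [hΛe, one_le_div (mul_pos hr (he0 j))]
      have : r * e j ≤ 1 := mul_le_one₀ hr1 (he0 j).le (he1 j)
      linarith
    have hη : IsCutoff η y r Λ := ⟨hη1, hη2, hη3, fun x hx => hη5 x fun h =>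
      hx (Metric.ball_subset_ball (hρr j) h), hη6⟩
    have hκd : κ j - κ (j + 1) = (1 - b) * M * e j / 2 := by simp only [hκ, hes]; ring
    have hκ' : κ (j + 1) < κ j := by
      have := mul_pos hb' (he0 j)
      linarith
    have hES : volume.real {x | u x < κ j ∧ η x ≠ 0} ≤ volume.real (S j) := by
      refine measureReal_mono (fun x hx => ⟨hx.1, ?_⟩) (hSfin j)
      by_contra h
      exact hx.2 (hη5 x h)
    obtain ⟨hw, hi₁, hi₂⟩ := hu.1.testFun hΩ hr hball (κ j) hη (by omega : m ≠ 0)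
    obtain ⟨hWi, hW⟩ := caccioppoli hN hp hs₀ hs₁ hm hH hε₀ hε₁ hΩ (le_max_right Γ 0)
      (hg.mono fun x hx => hx.trans (le_max_left Γ 0)) hum hu hsup hr hball hη hΛ1 hK0 (hkK j)
      (hkK' j)
    have hgrad := lintegral_testGrad_le hp hm2 hum hη hΛ1 hK0 (hkK j) hi₂ hWi hW
    have hΛ0 : 0 ≤ Λ := by linarith
    have hD : 0 ≤ (K * m + 1 + C) * Λ * volume.real (S j) := by positivity
    have hres := measureReal_sublevel_le (E' := S (j + 1)) hN (by omega) hη hκ' hD hw hi₁ hi₂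
      (hgrad.trans (ENNReal.ofReal_le_ofReal (by gcongr))) (fun x hx => ⟨hx.1, hη4 x hx.2⟩)
    have hSob : 0 ≤ sobolevConst N := NNReal.coe_nonneg _
    have hpos := hb'
    have hej := he0 j
    refine hres.trans (Real.rpow_le_rpow ?_ ?_ (by positivity))
    · rw [hκd]; positivity
    · have h4 : (4 : ℝ) ^ j * (e j * e j) = 1 := by
        simp only [he]
        rw [← mul_pow, ← mul_pow]; norm_num
      calc sobolevConst N * ((K * m + 1 + C) * Λ * volume.real (S j)) / (κ j - κ (j + 1))
          = sobolevConst N * ((K * m + 1 + C) * (8 * K₀)) * 2 / ((1 - b) * M)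
              * (4 ^ j * (volume.real (S j) / r)) := by
            have h5 : (4 : ℝ) ^ j = 1 / (e j * e j) := by
              rw [eq_div_iff (by positivity)]; exact h4
            rw [hκd, hΛe, h5]
            have : (1 - b) ≠ 0 := (sub_pos.2 hb₁).ne'
            field_simp
        _ ≤ A * (4 ^ j * (volume.real (S j) / r)) := by
            gcongr
            exact le_max_right _ _
        _ = A * 4 ^ j * (volume.real (S j) / r) := by ring
  -- rescaled measures
  have hrN : 0 < r ^ N := by positivity
  have hlim := hδ (fun j => volume.real (S j) / r ^ N) (fun j => by positivity) ?_ ?_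
  · have hzero : volume.real ({x | u x < μ + b * M} ∩ Metric.ball y (3 / 4 * r)) = 0 := by
      have hle : ∀ j, volume.real ({x | u x < μ + b * M} ∩ Metric.ball y (3 / 4 * r)) / r ^ N
          ≤ volume.real (S j) / r ^ N := by
        intro j
        refine div_le_div_of_nonneg_right (measureReal_mono ?_ (hSfin j)) hrN.le
        refine inter_subset_inter (fun x hx => ?_) (Metric.ball_subset_ball ?_)
        · have := mul_pos hb' (he0 j)
          simp only [mem_ofPred_eq] at hx ⊢
          simp only [hκ]; linarith
        · have := he0 j
          simp only [hρ]
          have : 0 ≤ r / 4 * e j := by positivity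
          linarith
      have h0 := ge_of_tendsto' hlim hle
      have h1 : 0 ≤ volume.real ({x | u x < μ + b * M} ∩ Metric.ball y (3 / 4 * r)) / r ^ N := by
        positivity
      have h2 := le_antisymm h0 h1
      exact (div_eq_zero_iff.1 h2).resolve_right hrN.ne'
    have hzero' : volume ({x | u x < μ + b * M} ∩ Metric.ball y (3 / 4 * r)) = 0 :=
      (measureReal_eq_zero_iff
        (measure_ne_top_of_subset inter_subset_right measure_ball_lt_top.ne)).1 hzero
    rw [ae_restrict_iff' measurableSet_ball, ae_iff]
    refine measure_mono_null (fun x hx => ?_) hzero'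
    simp only [mem_ofPred_eq, Classical.not_imp, not_le] at hx
    exact ⟨hx.2, hx.1⟩
  · -- the initial value is small
    have hball_vol : volume.real (Metric.ball y r) = r ^ N * vB := by
      rw [measureReal_def, Measure.addHaar_ball_of_pos volume y hr, finrank_euclideanSpace_fin,
        ENNReal.toReal_mul, ENNReal.toReal_ofReal hrN.le, hvB, measureReal_def]
    have hS0 : volume.real (S 0) ≤ min (1 / 2) (δ / vB) * volume.real (Metric.ball y r) := by
      have hsub : S 0 ⊆ {x | u x ≤ μ + M} ∩ Metric.ball y r := by
        refine inter_subset_inter (fun x hx => ?_) (Metric.ball_subset_ball (hρr 0))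
        simp only [mem_ofPred_eq] at hx ⊢
        exact hx.le.trans (hκM 0)
      have h1 := (measure_mono hsub).trans hsmall
      have h2 := ENNReal.toReal_mono
        (ENNReal.mul_ne_top ENNReal.ofReal_ne_top measure_ball_lt_top.ne) h1
      rwa [ENNReal.toReal_mul, ENNReal.toReal_ofReal (by positivity)] at h2
    rw [div_le_iff₀ hrN]
    calc volume.real (S 0) ≤ min (1 / 2) (δ / vB) * volume.real (Metric.ball y r) := hS0
      _ ≤ δ / vB * (r ^ N * vB) := by
          rw [hball_vol]
          gcongr
          exact min_le_right _ _
      _ = δ * r ^ N := by field_simp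
  · -- the recursion is scale invariant, since `(N - 1) q = N`
    intro j
    rw [div_le_iff₀ hrN]
    refine (hstep j).trans (le_of_eq ?_)
    have h1 : volume.real (S j) / r = volume.real (S j) / r ^ N * r ^ ((N : ℝ) - 1) := by
      rw [Real.rpow_sub_one hr.ne', Real.rpow_natCast]
      field_simp
    rw [h1, ← mul_assoc, Real.mul_rpow (by positivity) (by positivity), ← Real.rpow_mul hr.le,
      sub_one_mul_sobolevExponent hN, Real.rpow_natCast]

end DeGiorgi

/-! ### Lower semicontinuity -/

section Semicontinuity

variable {N : ℕ}

lemma essInfBall_le_lscRegularization (u : Space N → ℝ) (x : Space N) {r : ℝ} (hr : 0 < r) :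
    essInfBall u x r ≤ lscRegularization u x := by
  refine ge_of_tendsto (tendsto_lscRegularization u x) ?_
  filter_upwards [Ioo_mem_nhdsGT hr] with t ht using essInfBall_antitone u x ht.2.le

lemma lowerSemicontinuous_lscRegularization (u : Space N → ℝ) :
    LowerSemicontinuous (lscRegularization u) := by
  intro x a ha
  obtain ⟨r, har, hr⟩ := (((tendsto_lscRegularization u x).eventually (lt_mem_nhds ha)).and
    self_mem_nhdsWithin).exists
  filter_upwards [Metric.ball_mem_nhds x hr] with z hz
  have hd : 0 < r - dist z x := sub_pos.2 hz
  refine har.trans_le (le_trans ?_ (essInfBall_le_lscRegularization u z hd))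
  refine essInf_antitone_measure (Measure.restrict_mono ?_ le_rfl).absolutelyContinuous
  exact Metric.ball_subset_ball' (by linarith)

lemma eventually_closedBall_subset {Ω : Set (Space N)} (hΩ : IsOpen Ω) {x : Space N} (hx : x ∈ Ω) :
    ∀ᶠ r in 𝓝[>] (0 : ℝ), Metric.closedBall x r ⊆ Ω := by
  obtain ⟨d, hd, hsub⟩ := Metric.nhds_basis_closedBall.mem_iff.1 (hΩ.mem_nhds hx)
  filter_upwards [Ioo_mem_nhdsGT hd] with r hr
  exact (Metric.closedBall_subset_closedBall hr.2.le).trans hsub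

lemma integrableOn_abs_sub_of_locallyIntegrableOn {Ω : Set (Space N)} {u : Space N → ℝ}
    (hu : LocallyIntegrableOn u Ω) {x : Space N} {r : ℝ} (hr : Metric.closedBall x r ⊆ Ω) (c : ℝ) :
    IntegrableOn (fun y => |c - u y|) (Metric.ball x r) := by
  have h1 : IntegrableOn u (Metric.ball x r) :=
    (hu.integrableOn_compact_subset hr (isCompact_closedBall x r)).mono_set
      Metric.ball_subset_closedBall
  have h2 : IntegrableOn (fun _ : Space N => c) (Metric.ball x r) :=
    integrableOn_const measure_ball_lt_top.ne
  exact (h2.sub h1).abs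

lemma mul_measureReal_le_average {Ω : Set (Space N)} {u : Space N → ℝ}
    (hu : LocallyIntegrableOn u Ω) {x : Space N} {r : ℝ} (hr₀ : 0 < r)
    (hr : Metric.closedBall x r ⊆ Ω) (c d : ℝ) :
    d * volume.real ({y | d ≤ |c - u y|} ∩ Metric.ball x r)
      ≤ volume.real (Metric.ball x r) * ⨍ y in Metric.ball x r, |c - u y| := by
  have hint := integrableOn_abs_sub_of_locallyIntegrableOn hu hr c
  have h := mul_meas_ge_le_integral_of_nonneg
    (Eventually.of_forall fun y => abs_nonneg (c - u y)) hint d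
  have hpos : 0 < volume.real (Metric.ball x r) :=
    ENNReal.toReal_pos (Metric.measure_ball_pos volume x hr₀).ne' measure_ball_lt_top.ne
  rw [setAverage_eq, smul_eq_mul, mul_inv_cancel_left₀ hpos.ne']
  refine le_trans (le_of_eq ?_) h
  rw [measureReal_def, measureReal_def, Measure.restrict_apply' measurableSet_ball]

/-- At a Lebesgue point the regularization does not exceed the value of the function, because an
essential infimum does not exceed a mean value. -/
lemma lscRegularization_le {Ω : Set (Space N)} (hΩ : IsOpen Ω) {u : Space N → ℝ}
    (hu : LocallyIntegrableOn u Ω) {x : Space N} (hx : x ∈ lebesguePoints Ω u) :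
    lscRegularization u x ≤ (u x : EReal) := by
  by_contra! h
  obtain ⟨c, hc₁, hc₂⟩ := EReal.lt_iff_exists_real_btwn.1 h
  have hd : 0 < c - u x := sub_pos.2 (by exact_mod_cast hc₁)
  refine absurd (ge_of_tendsto hx.2 (b := c - u x) ?_) (not_le.2 hd)
  filter_upwards [(tendsto_lscRegularization u x).eventually (lt_mem_nhds hc₂),
    eventually_closedBall_subset hΩ hx.1, self_mem_nhdsWithin] with r h1 h2 h3
  have hint := integrableOn_abs_sub_of_locallyIntegrableOn hu h2 (u x)
  have hpos : 0 < volume.real (Metric.ball x r) :=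
    ENNReal.toReal_pos (Metric.measure_ball_pos volume x h3).ne' measure_ball_lt_top.ne
  rw [setAverage_eq, smul_eq_mul, le_inv_mul_iff₀ hpos]
  have hc : ∫ _ in Metric.ball x r, (c - u x) = volume.real (Metric.ball x r) * (c - u x) := by
    rw [setIntegral_const, smul_eq_mul]
  rw [← hc]
  refine integral_mono_ae (integrableOn_const measure_ball_lt_top.ne) hint ?_
  filter_upwards [ae_lt_of_lt_essInf h1] with z hz
  have hz' : c < u z := by exact_mod_cast hz
  rw [abs_sub_comm]
  exact (by linarith : c - u x ≤ u z - u x).trans (le_abs_self _)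

/-- If the measure-to-pointwise property holds at all levels, the function does not exceed its
regularization at Lebesgue points. -/
lemma le_lscRegularization {Ω : Set (Space N)} (hΩ : IsOpen Ω) {u : Space N → ℝ}
    (hu : LocallyIntegrableOn u Ω) {lam : ℝ} (hlam : ∀ᵐ x, lam ≤ u x)
    (hD : ∀ b M μ : ℝ, 0 < b → b < 1 → 0 < M →
      ∃ τ : ℝ, 0 < τ ∧ DeGiorgiProperty Ω u b (3 / 4) M μ τ) {x : Space N}
    (hx : x ∈ lebesguePoints Ω u) :
    (u x : EReal) ≤ lscRegularization u x := by
  by_contra! h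
  obtain ⟨c, hc₁, hc₂⟩ := EReal.lt_iff_exists_real_btwn.1 h
  have hcx : c < u x := by exact_mod_cast hc₂
  -- the levels `μ < c < t < u x`, with `μ + M = t` and `μ + b M = c`
  set t : ℝ := (c + u x) / 2 with ht
  set μ : ℝ := min lam (c - 1) with hμ
  have hμc : μ < c := (min_le_right _ _).trans_lt (by linarith)
  have hct : c < t := by rw [ht]; linarith
  have hM : 0 < t - μ := by linarith
  obtain ⟨τ, hτ, hprop⟩ := hD ((c - μ) / (t - μ)) (t - μ) μ
    (div_pos (by linarith) hM) ((div_lt_one hM).2 (by linarith)) hM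
  have hd : 0 < u x - t := by rw [ht]; linarith
  have hev : ∀ᶠ r in 𝓝[>] (0 : ℝ), ⨍ y in Metric.ball x r, |u x - u y| < τ * (u x - t) :=
    hx.2.eventually (gt_mem_nhds (mul_pos hτ hd))
  obtain ⟨r, h1, h2, h3⟩ := (hev.and ((eventually_closedBall_subset hΩ hx.1).and
    (Ioo_mem_nhdsGT one_pos))).exists
  have hmeas : volume ({z | u z ≤ μ + (t - μ)} ∩ Metric.ball x r)
      ≤ ENNReal.ofReal τ * volume (Metric.ball x r) := by
    have h4 := mul_measureReal_le_average hu h3.1 h2 (u x) (u x - t)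
    have h5 : volume.real ({z | u x - t ≤ |u x - u z|} ∩ Metric.ball x r)
        ≤ τ * volume.real (Metric.ball x r) := by
      refine le_of_mul_le_mul_left (h4.trans ?_) hd
      calc volume.real (Metric.ball x r) * ⨍ y in Metric.ball x r, |u x - u y|
          ≤ volume.real (Metric.ball x r) * (τ * (u x - t)) := by gcongr
        _ = _ := by ring
    calc volume ({z | u z ≤ μ + (t - μ)} ∩ Metric.ball x r)
        ≤ volume ({z | u x - t ≤ |u x - u z|} ∩ Metric.ball x r) := by
          refine measure_mono (inter_subset_inter_left _ fun z hz => ?_)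
          simp only [mem_ofPred_eq, add_sub_cancel] at hz ⊢
          exact (by linarith : u x - t ≤ u x - u z).trans (le_abs_self _)
      _ = ENNReal.ofReal (volume.real ({z | u x - t ≤ |u x - u z|} ∩ Metric.ball x r)) :=
          (ofReal_measureReal
            (measure_ne_top_of_subset inter_subset_right measure_ball_lt_top.ne)).symm
      _ ≤ ENNReal.ofReal (τ * volume.real (Metric.ball x r)) := ENNReal.ofReal_le_ofReal h5
      _ = _ := by
          rw [ENNReal.ofReal_mul hτ.le, ofReal_measureReal measure_ball_lt_top.ne]
  have hres := hprop x r h3.1 h3.2.le h2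
    (ae_restrict_of_ae (hlam.mono fun z hz => (min_le_left _ _).trans hz)) hmeas
  rw [div_mul_cancel₀ _ hM.ne', add_sub_cancel] at hres
  have hle : (c : EReal) ≤ essInfBall u x (3 / 4 * r) :=
    le_essInf_of_ae_le _ (hres.mono fun z hz => EReal.coe_le_coe_iff.2 hz)
  have hr' : 0 < 3 / 4 * r := mul_pos (by norm_num) h3.1
  exact absurd (hle.trans (essInfBall_le_lscRegularization u x hr')) (not_le.2 hc₁)

/-- Lebesgue's differentiation theorem in an open set, with open balls. -/
lemma ae_mem_lebesguePoints (hN : 2 ≤ N) {Ω : Set (Space N)} (hΩ : IsOpen Ω) {u : Space N → ℝ}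
    (hu : LocallyIntegrableOn u Ω) : ∀ᵐ x ∂volume.restrict Ω, x ∈ lebesguePoints Ω u := by
  have hNe := nontrivial_space hN
  rw [ae_restrict_iff' hΩ.measurableSet, ae_iff]
  refine measure_null_of_locally_null _ fun x hx => ?_
  simp only [mem_ofPred_eq, Classical.not_imp] at hx
  obtain ⟨d, hd, hsub⟩ := Metric.nhds_basis_closedBall.mem_iff.1 (hΩ.mem_nhds hx.1)
  set f := (Metric.closedBall x d).indicator u with hf
  have hfi : Integrable f := (hu.integrableOn_compact_subset hsub
    (isCompact_closedBall x d)).integrable_indicator measurableSet_closedBall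
  have hae : ∀ᵐ y, Tendsto (fun r => ⨍ z in Metric.closedBall y r, ‖f z - f y‖) (𝓝[>] 0)
      (𝓝 0) := by
    filter_upwards [(Besicovitch.vitaliFamily volume).ae_tendsto_average_norm_sub
      hfi.locallyIntegrable] with y hy
    exact hy.comp (Besicovitch.tendsto_filterAt volume y)
  refine ⟨_, inter_mem self_mem_nhdsWithin (mem_nhdsWithin_of_mem_nhds
    (Metric.ball_mem_nhds x hd)), measure_mono_null ?_ (ae_iff.1 hae)⟩
  rintro y ⟨hy, hyd⟩ hlim
  refine hy fun hyΩ => ⟨hyΩ, hlim.congr' ?_⟩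
  have hyd' : 0 < d - dist y x := sub_pos.2 hyd
  filter_upwards [Ioo_mem_nhdsGT hyd'] with r hr
  have hball : Metric.closedBall y r ⊆ Metric.closedBall x d :=
    Metric.closedBall_subset_closedBall' (by linarith [hr.2])
  have hae_eq : Metric.ball y r =ᵐ[volume] Metric.closedBall y r :=
    ae_eq_of_subset_of_measure_ge Metric.ball_subset_closedBall
      (Measure.addHaar_closedBall_eq_addHaar_ball volume y r).le
      measurableSet_ball.nullMeasurableSet measure_closedBall_lt_top.ne
  rw [setAverage_congr hae_eq]
  refine setAverage_congr_fun measurableSet_closedBall (Eventually.of_forall fun z hz => ?_)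
  rw [hf, indicator_of_mem (hball hz), indicator_of_mem (Metric.ball_subset_closedBall hyd),
    Real.norm_eq_abs, abs_sub_comm]

end Semicontinuity

end MixedAnisotropic

theorem mainTheorem5 (N : ℕ) (hN : 2 ≤ N) (p s : ℝ) (hp : 1 < p) (hs₀ : 0 < s) (hs₁ : s < 1)
    (C₁ C₂ : ℝ) :
    -- lower semicontinuity
    (∀ (Ω : Set (MixedAnisotropic.Space N)) (g H u : MixedAnisotropic.Space N → ℝ) (ε : ℝ),
      IsOpen Ω → MemLp g ∞ (volume.restrict Ω) →
      MixedAnisotropic.IsFinslerMinkowski C₁ C₂ H → 0 < ε → ε ≤ 1 →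
      MixedAnisotropic.IsWeakSupersolution p s ε H g Ω u →
      (∃ m : ℝ, ∀ᵐ x, m ≤ u x) →
        (∀ x ∈ MixedAnisotropic.lebesguePoints Ω u,
          (u x : EReal) = MixedAnisotropic.lscRegularization u x) ∧
        LowerSemicontinuousOn (MixedAnisotropic.lscRegularization u) Ω ∧
        (∀ᵐ x ∂volume.restrict Ω, MixedAnisotropic.lscRegularization u x = (u x : EReal))) ∧
    -- property (D), with a constant that depends only on the data
    (∀ b M μ lam Γ : ℝ, 0 < b → b < 1 → 0 < M →
      ∃ τ : ℝ, 0 < τ ∧ τ < 1 ∧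
        ∀ (Ω : Set (MixedAnisotropic.Space N)) (g H u : MixedAnisotropic.Space N → ℝ) (ε : ℝ),
          IsOpen Ω → MemLp g ∞ (volume.restrict Ω) →
          (∀ᵐ x ∂volume.restrict Ω, |g x| ≤ Γ) →
          MixedAnisotropic.IsFinslerMinkowski C₁ C₂ H → 0 < ε → ε ≤ 1 →
          MixedAnisotropic.IsWeakSupersolution p s ε H g Ω u →
          (∀ᵐ x, lam ≤ u x) →
            MixedAnisotropic.DeGiorgiProperty Ω u b (3 / 4) M μ τ) := by
  refine ⟨?_, ?_⟩
  · rintro Ω g H u ε hΩ hg hH hε₀ hε₁ hsup ⟨lam, hlam⟩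
    have hu : LocallyIntegrableOn u Ω := by
      obtain ⟨-, G, hu, -⟩ := hsup
      exact hu.1.1
    have hΓ : ∀ᵐ x ∂volume.restrict Ω, |g x| ≤ (eLpNorm g ∞ (volume.restrict Ω)).toReal := by
      rw [eLpNorm_exponent_top]
      filter_upwards [ae_le_eLpNormEssSup (f := g) (μ := volume.restrict Ω)] with x hx
      have hfin : eLpNormEssSup g (volume.restrict Ω) ≠ ⊤ := by
        rw [← eLpNorm_exponent_top]; exact hg.2.ne
      have h := ENNReal.toReal_mono hfin hx
      rwa [toReal_enorm, Real.norm_eq_abs] at h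
    have hpt : ∀ x ∈ MixedAnisotropic.lebesguePoints Ω u,
        (u x : EReal) = MixedAnisotropic.lscRegularization u x := by
      intro x hx
      refine le_antisymm (MixedAnisotropic.le_lscRegularization hΩ hu hlam ?_ hx)
        (MixedAnisotropic.lscRegularization_le hΩ hu hx)
      intro b M μ _ hb₁ hM
      obtain ⟨τ, hτ, -, h⟩ := MixedAnisotropic.exists_deGiorgiProperty hN hp hs₀ hs₁ C₁ C₂ b M μ lam
        (eLpNorm g ∞ (volume.restrict Ω)).toReal hb₁ hM
      exact ⟨τ, hτ, h Ω g H u ε hΩ hΓ hH hε₀ hε₁ hsup hlam⟩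
    refine ⟨hpt, (MixedAnisotropic.lowerSemicontinuous_lscRegularization u).lowerSemicontinuousOn _,
      ?_⟩
    filter_upwards [MixedAnisotropic.ae_mem_lebesguePoints hN hΩ hu] with x hx
    exact (hpt x hx).symm
  · intro b M μ lam Γ _ hb₁ hM
    obtain ⟨τ, hτ₀, hτ₁, h⟩ :=
      MixedAnisotropic.exists_deGiorgiProperty hN hp hs₀ hs₁ C₁ C₂ b M μ lam Γ hb₁ hM
    exact ⟨τ, hτ₀, hτ₁, fun Ω g H u ε hΩ _ hg hH hε₀ hε₁ hsup hlam =>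
      h Ω g H u ε hΩ hg hH hε₀ hε₁ hsup hlam⟩
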